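/- Let $G$ be a finite group. A $G$-Tambara functor $R$ assigns to every finite $G$-set $X$ a commutative ring $R(X)$, with restrictions (ring homomorphisms), transfers (additive maps) and norms (multiplicative maps) along all maps of finite $G$-sets, each functorial, such that disjoint unions are sent to products, transfers and norms satisfy base change along pullback squares, and norms distribute over transfers along exponential diagrams. A Tambara ideal $I$ of $R$ is a family of ideals $I(G/H)\subseteq R(G/H)$, for $H\le G$, closed under restrictions, transfers, norms and conjugations. The product $I\cdot J$ is the smallest Tambara ideal containing $I(G/H)\cdot J(G/H)$ for all $H\le G$. A Tambara ideal $\mathfrak p$ is prime if $\mathfrak p\neq R$ and $I\cdot J\subseteq\mathfrak p$ implies $I\subseteq\mathfrak p$ or $J\subseteq\mathfrak p$. The Nakaoka spectrum $\mathrm{Spec}(R)$ is the set of prime Tambara ideals of $R$, with the topology generated by the closed subsets $V(I)=\{\mathfrak p : I\subseteq\mathfrak p\}$, for $I$ a Tambara ideal. The group $G$ acts on $R(G/e)$ by restriction along right multiplications on $G/e$; $R$ is clarified if there is no nonzero idempotent $d\in R(G/e)$ with $d\cdot gd=0$ for some $g\in G$. The same notions apply to every subgroup $H$ of $G$ in place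 of $G$. Theorem. Let $R$ be a $G$-Tambara functor such that the ring $R(G/e)$ is Noetherian. Then there is a family $(R_H)_{H\le G}$, indexed by all subgroups $H$ of $G$, in which each $R_H$ is a clarified $H$-Tambara functor (possibly zero), and a homeomorphism $$\mathrm{Spec}(R)\;\cong\;\coprod_{H\le G}\mathrm{Spec}(R_H).$$ -/

import Mathlib

universe u v

section GSets

variable {G : Type u} [Group G]

/-- The commutative square of `G`-sets with top `u : E → X`, left `v : E → B`, right `f : X → Y`
and bottom `q : B → Y` is a pullback square. -/
structure IsPullbackSquare {E X B Y : Type u} [MulAction G E] [MulAction G X] [MulAction G B]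
    [MulAction G Y] (u : E →[G] X) (v : E →[G] B) (f : X →[G] Y) (q : B →[G] Y) : Prop where
  comm : ∀ t, f (u t) = q (v t)
  existsUnique : ∀ x b, f x = q b → ∃! t, u t = x ∧ v t = b

/-- The diagram `X ←p- A ←e- E -f'→ B -q→ Y`, together with `f : X → Y`, is an exponential diagram:
`B` is the dependent product of `p : A → X` along `f` (a point of `B` over `y` is a section of `p`
over the fibre of `f` at `y`), `E` is the pullback `X ×_Y B`, and `e : E → A` is the evaluation. -/
structure IsExponentialDiagram {X Y A B E : Type u} [MulAction G X] [MulAction G Y] [MulAction G A]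
    [MulAction G B] [MulAction G E] (p : A →[G] X) (f : X →[G] Y) (e : E →[G] A) (f' : E →[G] B)
    (q : B →[G] Y) : Prop where
  isPullback : IsPullbackSquare (p.comp e) f' f q
  existsUnique : ∀ (y : Y) (s : {x : X // f x = y} → A), (∀ x, p (s x) = x) →
    ∃! b : B, q b = y ∧
      ∀ (t : E) (x : {x : X // f x = y}), f' t = b → p (e t) = x → e t = s x

end GSets

/-- A `G`-Tambara functor, for a finite group `G`, given by its values on all finite `G`-sets:
commutative rings `obj X` with restrictions, transfers and norms along all maps of `G`-sets, which
turn disjoint unions into products, satisfy base change along pullback squares, and satisfy the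
distributive law for exponential diagrams. -/
structure TambaraFunctor (G : Type u) [Group G] where
  obj (X : Type u) [MulAction G X] [Finite X] : Type v
  [commRing (X : Type u) [MulAction G X] [Finite X] : CommRing (obj X)]
  /-- restriction -/
  res {X Y : Type u} [MulAction G X] [Finite X] [MulAction G Y] [Finite Y] (f : X →[G] Y) :
    obj Y →+* obj X
  /-- transfer -/
  tr {X Y : Type u} [MulAction G X] [Finite X] [MulAction G Y] [Finite Y] (f : X →[G] Y) :
    obj X →+ obj Y
  /-- norm -/
  nm {X Y : Type u} [MulAction G X] [Finite X] [MulAction G Y] [Finite Y] (f : X →[G] Y) :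
    obj X →* obj Y
  res_id (X : Type u) [MulAction G X] [Finite X] (a : obj X) : res (MulActionHom.id G) a = a
  tr_id (X : Type u) [MulAction G X] [Finite X] (a : obj X) : tr (MulActionHom.id G) a = a
  nm_id (X : Type u) [MulAction G X] [Finite X] (a : obj X) : nm (MulActionHom.id G) a = a
  res_comp {X Y Z : Type u} [MulAction G X] [Finite X] [MulAction G Y] [Finite Y] [MulAction G Z]
    [Finite Z] (g : Y →[G] Z) (f : X →[G] Y) (a : obj Z) : res (g.comp f) a = res f (res g a)
  tr_comp {X Y Z : Type u} [MulAction G X] [Finite X] [MulAction G Y] [Finite Y] [MulAction G Z]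
    [Finite Z] (g : Y →[G] Z) (f : X →[G] Y) (a : obj X) : tr (g.comp f) a = tr g (tr f a)
  nm_comp {X Y Z : Type u} [MulAction G X] [Finite X] [MulAction G Y] [Finite Y] [MulAction G Z]
    [Finite Z] (g : Y →[G] Z) (f : X →[G] Y) (a : obj X) : nm (g.comp f) a = nm g (nm f a)
  /-- The value at the empty `G`-set is the zero ring. -/
  subsingleton_of_isEmpty (X : Type u) [MulAction G X] [Finite X] [IsEmpty X] :
    Subsingleton (obj X)
  /-- If `Z` is the disjoint union of `X` and `Y` via `i` and `j`, then
  `obj Z → obj X × obj Y` is bijective. -/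
  bijective_of_sum {X Y Z : Type u} [MulAction G X] [Finite X] [MulAction G Y] [Finite Y]
    [MulAction G Z] [Finite Z] (i : X →[G] Z) (j : Y →[G] Z)
    (h : Function.Bijective (Sum.elim i j : X ⊕ Y → Z)) :
    Function.Bijective (fun a : obj Z => (res i a, res j a))
  /-- Base change for transfers. -/
  res_tr {E X B Y : Type u} [MulAction G E] [Finite E] [MulAction G X] [Finite X] [MulAction G B]
    [Finite B] [MulAction G Y] [Finite Y] {u : E →[G] X} {v : E →[G] B} {f : X →[G] Y}
    {q : B →[G] Y} (h : IsPullbackSquare u v f q) (a : obj X) : res q (tr f a) = tr v (res u a)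
  /-- Base change for norms. -/
  res_nm {E X B Y : Type u} [MulAction G E] [Finite E] [MulAction G X] [Finite X] [MulAction G B]
    [Finite B] [MulAction G Y] [Finite Y] {u : E →[G] X} {v : E →[G] B} {f : X →[G] Y}
    {q : B →[G] Y} (h : IsPullbackSquare u v f q) (a : obj X) : res q (nm f a) = nm v (res u a)
  /-- Distributivity of norms over transfers. -/
  nm_tr {X Y A B E : Type u} [MulAction G X] [Finite X] [MulAction G Y] [Finite Y] [MulAction G A]
    [Finite A] [MulAction G B] [Finite B] [MulAction G E] [Finite E] {p : A →[G] X} {f : X →[G] Y}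
    {e : E →[G] A} {f' : E →[G] B} {q : B →[G] Y} (h : IsExponentialDiagram p f e f' q)
    (a : obj A) : nm f (tr p a) = tr q (nm f' (res e a))

namespace TambaraFunctor

variable {G : Type u} [Group G]

attribute [instance] TambaraFunctor.commRing

/-- Right multiplication by `g` on the `G`-set `G/e`. -/
def rightMul (g : G) : (G ⧸ (⊥ : Subgroup G)) →[G] (G ⧸ (⊥ : Subgroup G)) where
  toFun x := x * (g : G ⧸ (⊥ : Subgroup G))
  map_smul' a x := by
    induction x using QuotientGroup.induction_on with
    | H b => exact congrArg (QuotientGroup.mk (s := (⊥ : Subgroup G))) (mul_assoc a b g)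

variable [Finite G] (R : TambaraFunctor.{u, v} G)

/-- The ring `R(G/H)`. -/
abbrev level (H : Subgroup G) : Type v := R.obj (G ⧸ H)

/-- The action of `g : G` on the ring `R(G/e)`: restriction along right multiplication by `g`. -/
def conj (g : G) : R.level ⊥ →+* R.level ⊥ := R.res (rightMul g)

/-- `R` is clarified if `R(G/e)` has no nonzero idempotent `d` with `d * g d = 0` for some `g`. -/
def IsClarified : Prop :=
  ¬ ∃ d : R.level ⊥, d ≠ 0 ∧ IsIdempotentElem d ∧ ∃ g : G, d * R.conj g d = 0

/-- A Tambara ideal of `R`: ideals of the rings `R(G/H)` which are closed under transfers, norms and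
restrictions along all maps `G/K → G/H` of `G`-sets. Each such map is a conjugation isomorphism
followed by a projection `G/K' → G/H` with `K' ≤ H`, so this comprises transfers, norms and
restrictions along inclusions of subgroups, and conjugations. -/
@[ext]
structure TambaraIdeal where
  carrier : ∀ H : Subgroup G, Ideal (R.level H)
  tr_mem : ∀ {K H : Subgroup G} (f : (G ⧸ K) →[G] (G ⧸ H)) {a : R.level K},
    a ∈ carrier K → R.tr f a ∈ carrier H
  nm_mem : ∀ {K H : Subgroup G} (f : (G ⧸ K) →[G] (G ⧸ H)) {a : R.level K},
    a ∈ carrier K → R.nm f a ∈ carrier H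
  res_mem : ∀ {K H : Subgroup G} (f : (G ⧸ K) →[G] (G ⧸ H)) {a : R.level H},
    a ∈ carrier H → R.res f a ∈ carrier K

namespace TambaraIdeal

variable {R}

/-- Levelwise inclusion of Tambara ideals. -/
instance : PartialOrder R.TambaraIdeal :=
  PartialOrder.lift TambaraIdeal.carrier (fun _ _ h => TambaraIdeal.ext h)

/-- The unit ideal. -/
instance : Top R.TambaraIdeal where
  top :=
    { carrier := fun _ => ⊤
      tr_mem := fun _ _ _ => Submodule.mem_top
      nm_mem := fun _ _ _ => Submodule.mem_top
      res_mem := fun _ _ _ => Submodule.mem_top }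

/-- The levelwise intersection of a set of Tambara ideals. -/
instance : InfSet R.TambaraIdeal where
  sInf S :=
    { carrier := fun H => ⨅ I ∈ S, I.carrier H
      tr_mem := fun f _ ha => by
        simp only [Submodule.mem_iInf] at ha ⊢
        exact fun I hI => I.tr_mem f (ha I hI)
      nm_mem := fun f _ ha => by
        simp only [Submodule.mem_iInf] at ha ⊢
        exact fun I hI => I.nm_mem f (ha I hI)
      res_mem := fun f _ ha => by
        simp only [Submodule.mem_iInf] at ha ⊢
        exact fun I hI => I.res_mem f (ha I hI) }

/-- The product of `I` and `J`: the smallest Tambara ideal that contains all products `a * b` with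
`a` in `I(G/H)` and `b` in `J(G/H)`. -/
instance : Mul R.TambaraIdeal where
  mul I J := sInf {L | ∀ (H : Subgroup G), ∀ a ∈ I.carrier H, ∀ b ∈ J.carrier H,
    a * b ∈ L.carrier H}

/-- A Tambara ideal is prime if it is proper and contains `I` or `J` whenever it contains `I * J`. -/
structure IsPrime (P : R.TambaraIdeal) : Prop where
  ne_top : P ≠ ⊤
  le_or_le : ∀ I J : R.TambaraIdeal, I * J ≤ P → I ≤ P ∨ J ≤ P

end TambaraIdeal

/-- The set of prime Tambara ideals of `R`. -/
structure NakaokaSpectrum where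
  ideal : R.TambaraIdeal
  isPrime : ideal.IsPrime

namespace NakaokaSpectrum

variable {R}

/-- The set `V(I)` of prime Tambara ideals that contain `I`. -/
def V (I : R.TambaraIdeal) : Set R.NakaokaSpectrum := {P | I ≤ P.ideal}

/-- The topology generated by the sets `V(I)` as closed sets. -/
instance : TopologicalSpace R.NakaokaSpectrum :=
  TopologicalSpace.generateFrom {U | ∃ I : R.TambaraIdeal, U = (V I)ᶜ}

end NakaokaSpectrum

end TambaraFunctor

/-! A Noetherian ring has finitely many idempotents, so `G` permutes the finite set of primitive
idempotents of `R(G/e)`. Choose one representative in each orbit and let `e H` be the sum of the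
representatives with stabilizer exactly `H`. The translates of the `e H` form a complete orthogonal
system `d`, indexed equivariantly by `T = ⨿ G/H` (`exists_orbit_idempotents`).

This system lives only at level `G/e`. A norm globalizes it: with `delta` the element of `R(G/e ×
T)` whose values are `d`, its norm `tau` to `R(T)` is idempotent, and its pullbacks along pointwise
different maps are orthogonal (`res_tau_mul_res_tau`). It is compatible with norms
(`res_tau_mul_nm`), and its transfer to the point is `1` (`tr_tau`). The last fact is
distributivity: `1 = nm (tr delta)` is a transfer from the `G`-set of functions `G/e → T`; the
constant functions contribute `tr tau` and the others contribute zero.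

On the summand `G/H` of `T`, `tau` is an idempotent of the restriction of `R` to `H`, and `R_H` is
its corner. Ideals are compared by `restrictIdeal` and its right adjoint `extendIdeal`. Restriction
after extension is the identity for the same `H` and the unit ideal for different ones, while `tr
tau = 1` shows that the intersection over `H` of the extended restrictions of `I` lies in `I`. A
prime containing a finite intersection contains one of its terms, so each prime of `R` is extended
from exactly one `R_H`. The images are finitely many disjoint closed sets, hence open.

`R_H` is clarified because a nonzero idempotent below `e H` dominates a primitive idempotent fixed
by `H`, and so does each of its translates by `H`. -/

namespace TambaraFunctor

/-! ### Maps, orbits and free points of `G`-sets. -/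

section GSetMaps

variable {G : Type u} [Group G]

/-- A map of sets compatible with the actions, as a map of `G`-sets. -/
@[simps]
def gMap {X Y : Type*} [MulAction G X] [MulAction G Y] (f : X → Y)
    (h : ∀ (g : G) (x : X), f (g • x) = g • f x) : X →[G] Y where
  toFun := f
  map_smul' := h

theorem coset_eq_smul_one {H : Subgroup G} (x : G ⧸ H) :
    ∃ g : G, x = g • ((1 : G) : G ⧸ H) := by
  induction x using QuotientGroup.induction_on with
  | H g => exact ⟨g, by rw [MulAction.Quotient.smul_coe, smul_eq_mul, mul_one]⟩

theorem hom_ext_one {H : Subgroup G} {X : Type*} [MulAction G X] {f f' : (G ⧸ H) →[G] X}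
    (h : f ((1 : G) : G ⧸ H) = f' ((1 : G) : G ⧸ H)) : f = f' := by
  ext x
  obtain ⟨g, rfl⟩ := coset_eq_smul_one x
  rw [map_smul, map_smul, h]

/-- The map `G/H → X` sending the base point to a point fixed by `H`. -/
def orbitMap (H : Subgroup G) {X : Type*} [MulAction G X] (x : X) (hx : ∀ h ∈ H, h • x = x) :
    (G ⧸ H) →[G] X :=
  gMap (Quotient.lift (fun g : G => g • x) (by
    intro a b hab
    have h := hx _ (QuotientGroup.leftRel_apply.1 hab)
    calc a • x = a • ((a⁻¹ * b) • x) := by rw [h]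
      _ = b • x := by rw [smul_smul, mul_inv_cancel_left])) (by
    intro g y
    induction y using QuotientGroup.induction_on with
    | H b => exact mul_smul g b x)

theorem orbitMap_one (H : Subgroup G) {X : Type*} [MulAction G X] (x : X)
    (hx : ∀ h ∈ H, h • x = x) : orbitMap H x hx ((1 : G) : G ⧸ H) = x := one_smul G x

theorem orbitMap_stabilizer_injective {X : Type*} [MulAction G X] (x : X) :
    Function.Injective (orbitMap (MulAction.stabilizer G x) x fun _ h => h) := by
  intro a b
  induction a using QuotientGroup.induction_on with
  | H a =>
  induction b using QuotientGroup.induction_on with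
  | H b =>
  intro h
  change a • x = b • x at h
  rw [QuotientGroup.eq, MulAction.mem_stabilizer_iff, mul_smul, ← h, inv_smul_smul]

/-- The map `G/e → X` sending the base point to `x`. -/
def pt {X : Type*} [MulAction G X] (x : X) : (G ⧸ (⊥ : Subgroup G)) →[G] X :=
  orbitMap ⊥ x fun _ h => by rw [Subgroup.mem_bot.1 h, one_smul]

theorem pt_one {X : Type*} [MulAction G X] (x : X) : pt x ((1 : G) : G ⧸ (⊥ : Subgroup G)) = x :=
  orbitMap_one _ _ _

theorem comp_pt {X Y : Type*} [MulAction G X] [MulAction G Y] (f : X →[G] Y) (x : X) :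
    f.comp (pt x) = pt (f x) :=
  hom_ext_one (by rw [MulActionHom.comp_apply, pt_one, pt_one])

theorem pt_smul {X : Type*} [MulAction G X] (g : G) (x : X) :
    pt (g • x) = (pt x).comp (rightMul g) := by
  refine hom_ext_one ?_
  rw [pt_one, MulActionHom.comp_apply]
  change g • x = ((1 : G) * g) • x
  rw [one_mul]

/-- A map of `G`-sets lifts along an injective one if its range is covered. -/
theorem exists_lift {X Y Z : Type*} [MulAction G X] [MulAction G Y] [MulAction G Z]
    (f : X →[G] Z) (i : Y →[G] Z) (hi : Function.Injective i) (h : ∀ x, ∃ y, i y = f x) :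
    ∃ k : X →[G] Y, i.comp k = f := by
  choose k hk using h
  refine ⟨gMap k fun g x => hi ?_, ?_⟩
  · rw [hk, map_smul, map_smul, hk]
  · ext x
    exact hk x

theorem exists_lift_orbit {H : Subgroup G} {Y Z : Type*} [MulAction G Y] [MulAction G Z]
    (f : (G ⧸ H) →[G] Z) (i : Y →[G] Z) (hi : Function.Injective i) {y : Y}
    (h : i y = f ((1 : G) : G ⧸ H)) : ∃ k : (G ⧸ H) →[G] Y, i.comp k = f := by
  refine exists_lift f i hi fun x => ?_
  obtain ⟨g, rfl⟩ := coset_eq_smul_one x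
  exact ⟨g • y, by rw [map_smul, map_smul, h]⟩

/-- The action on an invariant subset. -/
abbrev subMulAction {X : Type*} [MulAction G X] (p : X → Prop)
    (h : ∀ (g : G) (x : X), p x → p (g • x)) : MulAction G {x : X // p x} where
  smul g x := ⟨g • x.1, h g x.1 x.2⟩
  one_smul x := Subtype.ext (one_smul G x.1)
  mul_smul a b x := Subtype.ext (mul_smul a b x.1)

/-- Every nonempty `G`-set is the disjoint union of an orbit and a smaller `G`-set. -/
theorem exists_orbit_decomposition {X : Type u} [MulAction G X] [Finite X] (x : X) :
    ∃ (H : Subgroup G) (Y : Type u) (_ : MulAction G Y) (_ : Finite Y) (i : (G ⧸ H) →[G] X)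
      (j : Y →[G] X), Function.Bijective (Sum.elim i j) ∧ i ((1 : G) : G ⧸ H) = x ∧
        Nat.card Y < Nat.card X := by
  let p : X → Prop := fun y => y ∉ MulAction.orbit G x
  let : MulAction G {y : X // p y} := subMulAction p fun g y hy ⟨k, hk⟩ =>
    hy ⟨g⁻¹ * k, by rw [← inv_smul_smul g y, ← hk, ← mul_smul]⟩
  refine ⟨MulAction.stabilizer G x, {y : X // p y}, inferInstance, inferInstance,
    orbitMap _ x fun _ h => h, gMap Subtype.val fun _ _ => rfl, ⟨?_, ?_⟩, orbitMap_one _ _ _, ?_⟩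
  · rintro (a | a) (b | b) h
    · exact congrArg _ (orbitMap_stabilizer_injective x h)
    · induction a using QuotientGroup.induction_on with
      | H a => exact (b.2 ⟨a, h⟩).elim
    · induction b using QuotientGroup.induction_on with
      | H b => exact (a.2 ⟨b, h.symm⟩).elim
    · exact congrArg _ (Subtype.ext h)
  · intro y
    by_cases hy : y ∈ MulAction.orbit G x
    · obtain ⟨g, rfl⟩ := hy
      exact ⟨Sum.inl (g : G ⧸ _), rfl⟩
    · exact ⟨Sum.inr ⟨y, hy⟩, rfl⟩
  · exact Finite.card_subtype_lt (x := x) fun h => h (MulAction.mem_orbit_self x)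

/-- Induction over finite `G`-sets by splitting off orbits. -/
theorem orbit_induction {P : ∀ (X : Type u) [MulAction G X] [Finite X], Prop}
    (empty : ∀ (X : Type u) [MulAction G X] [Finite X] [IsEmpty X], P X)
    (sum : ∀ (X Y : Type u) [MulAction G X] [Finite X] [MulAction G Y] [Finite Y] (H : Subgroup G)
      [Finite (G ⧸ H)] (i : (G ⧸ H) →[G] X) (j : Y →[G] X), Function.Bijective (Sum.elim i j) →
      P Y → P X)
    (X : Type u) [MulAction G X] [Finite X] : P X := by
  induction hn : Nat.card X using Nat.strong_induction_on generalizing X with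
  | _ n ih =>
    rcases isEmpty_or_nonempty X with hX | ⟨⟨x⟩⟩
    · exact empty X
    · obtain ⟨H, Y, _, _, i, j, hij, -, hc⟩ := exists_orbit_decomposition (G := G) x
      have : Finite (G ⧸ H) := Finite.of_injective i fun a b h =>
        Sum.inl_injective (hij.1 (a₁ := Sum.inl a) (a₂ := Sum.inl b) h)
      exact sum X Y H i j hij (ih _ (hn ▸ hc) Y rfl)

theorem orbit_hom_surjective {X : Type*} [MulAction G X] {H : Subgroup G} [Nonempty X]
    (f : X →[G] (G ⧸ H)) : Function.Surjective f := by
  intro y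
  obtain ⟨x⟩ := ‹Nonempty X›
  obtain ⟨g, rfl⟩ := coset_eq_smul_one y
  obtain ⟨k, hk⟩ := coset_eq_smul_one (f x)
  exact ⟨(g * k⁻¹) • x, by rw [map_smul, hk, smul_smul, inv_mul_cancel_right]⟩

variable {X Y Z : Type u} [MulAction G X] [MulAction G Y] [MulAction G Z]

/-- The empty `G`-set. -/
instance : MulAction G PEmpty.{u + 1} where
  smul _ x := x
  one_smul x := x.elim
  mul_smul _ _ x := x.elim

variable (G X) in
/-- The map from the empty `G`-set. -/
def fromEmpty : PEmpty.{u + 1} →[G] X := gMap PEmpty.elim fun _ x => x.elim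

theorem isPullbackSquare_fromEmpty (f : X →[G] Z) (q : Y →[G] Z) (h : ∀ x y, f x ≠ q y) :
    IsPullbackSquare (fromEmpty G X) (fromEmpty G Y) f q :=
  ⟨fun t => t.elim, fun x b hx => (h x b hx).elim⟩

variable {i : X →[G] Z} {j : Y →[G] Z}

theorem sum_injective_left (h : Function.Bijective (Sum.elim i j)) : Function.Injective i :=
  fun _ _ hab => Sum.inl_injective (h.1 hab)

theorem sum_injective_right (h : Function.Bijective (Sum.elim i j)) : Function.Injective j :=
  fun _ _ hab => Sum.inr_injective (h.1 hab)

theorem sum_disjoint (h : Function.Bijective (Sum.elim i j)) (x : X) (y : Y) : i x ≠ j y :=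
  fun hxy => Sum.inl_ne_inr (h.1 (a₁ := Sum.inl x) (a₂ := Sum.inr y) hxy)

theorem smul_bot_eq_self {g : G} {x : G ⧸ (⊥ : Subgroup G)} (h : g • x = x) : g = 1 := by
  induction x using QuotientGroup.induction_on with
  | H k =>
    have := QuotientGroup.eq.1 h
    rw [Subgroup.mem_bot] at this
    change (g * k)⁻¹ * k = 1 at this
    rwa [inv_mul_eq_one, mul_eq_right] at this

end GSetMaps

/-! ### Formal consequences of the Tambara axioms. -/

section Basic

variable {G : Type u} [Group G] (R : TambaraFunctor.{u, v} G)
variable {X Y Z : Type u} [MulAction G X] [Finite X] [MulAction G Y] [Finite Y]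
  [MulAction G Z] [Finite Z]

theorem res_tr_of_injective (f : X →[G] Y) (hf : Function.Injective f) (a : R.obj X) :
    R.res f (R.tr f a) = a := by
  have h : IsPullbackSquare (MulActionHom.id G : X →[G] X) (MulActionHom.id G) f f :=
    ⟨fun _ => rfl, fun x b h => ⟨x, ⟨rfl, hf h⟩, fun t ht => ht.1⟩⟩
  rw [R.res_tr h, R.res_id, R.tr_id]

theorem res_nm_of_injective (f : X →[G] Y) (hf : Function.Injective f) (a : R.obj X) :
    R.res f (R.nm f a) = a := by
  have h : IsPullbackSquare (MulActionHom.id G : X →[G] X) (MulActionHom.id G) f f :=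
    ⟨fun _ => rfl, fun x b h => ⟨x, ⟨rfl, hf h⟩, fun t ht => ht.1⟩⟩
  rw [R.res_nm h, R.res_id, R.nm_id]

instance [IsEmpty X] : Subsingleton (R.obj X) := R.subsingleton_of_isEmpty X

theorem res_tr_of_disjoint (f : X →[G] Z) (q : Y →[G] Z) (h : ∀ x y, f x ≠ q y) (a : R.obj X) :
    R.res q (R.tr f a) = 0 := by
  rw [R.res_tr (isPullbackSquare_fromEmpty f q h), Subsingleton.elim (R.res _ a) 0, map_zero]

theorem res_nm_of_disjoint (f : X →[G] Z) (q : Y →[G] Z) (h : ∀ x y, f x ≠ q y) (a : R.obj X) :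
    R.res q (R.nm f a) = 1 := by
  rw [R.res_nm (isPullbackSquare_fromEmpty f q h), Subsingleton.elim (R.res _ a) 1, map_one]

variable {i : X →[G] Z} {j : Y →[G] Z}

theorem ext_sum (h : Function.Bijective (Sum.elim i j)) {a b : R.obj Z}
    (hi : R.res i a = R.res i b) (hj : R.res j a = R.res j b) : a = b :=
  (R.bijective_of_sum i j h).1 (Prod.ext hi hj)

theorem eq_tr_add_tr (h : Function.Bijective (Sum.elim i j)) (a : R.obj Z) :
    a = R.tr i (R.res i a) + R.tr j (R.res j a) := by
  refine R.ext_sum h ?_ ?_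
  · rw [map_add, R.res_tr_of_injective i (sum_injective_left h),
      R.res_tr_of_disjoint j i fun y x => (sum_disjoint h x y).symm, add_zero]
  · rw [map_add, R.res_tr_of_injective j (sum_injective_right h),
      R.res_tr_of_disjoint i j (sum_disjoint h), zero_add]

theorem eq_nm_mul_nm (h : Function.Bijective (Sum.elim i j)) (a : R.obj Z) :
    a = R.nm i (R.res i a) * R.nm j (R.res j a) := by
  refine R.ext_sum h ?_ ?_
  · rw [map_mul, R.res_nm_of_injective i (sum_injective_left h),
      R.res_nm_of_disjoint j i fun y x => (sum_disjoint h x y).symm, mul_one]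
  · rw [map_mul, R.res_nm_of_injective j (sum_injective_right h),
      R.res_nm_of_disjoint i j (sum_disjoint h), one_mul]

theorem tr_eq_add {W : Type u} [MulAction G W] [Finite W] (h : Function.Bijective (Sum.elim i j))
    (f : Z →[G] W) (a : R.obj Z) :
    R.tr f a = R.tr (f.comp i) (R.res i a) + R.tr (f.comp j) (R.res j a) := by
  conv_lhs => rw [R.eq_tr_add_tr h a]
  rw [map_add, R.tr_comp, R.tr_comp]

theorem nm_eq_mul {W : Type u} [MulAction G W] [Finite W] (h : Function.Bijective (Sum.elim i j))
    (f : Z →[G] W) (a : R.obj Z) :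
    R.nm f a = R.nm (f.comp i) (R.res i a) * R.nm (f.comp j) (R.res j a) := by
  conv_lhs => rw [R.eq_nm_mul_nm h a]
  rw [map_mul, R.nm_comp, R.nm_comp]

theorem res_injective_of_bijective (f : X →[G] Y) (hf : Function.Bijective f) :
    Function.Injective (R.res f) := by
  obtain ⟨k, hk⟩ := exists_lift (MulActionHom.id G : Y →[G] Y) f hf.1 fun y => hf.2 y
  intro a b hab
  rw [← R.res_id Y a, ← hk, R.res_comp, hab, ← R.res_comp, hk, R.res_id]

theorem nm_res_of_bijective (f : X →[G] Y) (hf : Function.Bijective f) (a : R.obj Y) :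
    R.nm f (R.res f a) = a :=
  R.res_injective_of_bijective f hf (R.res_nm_of_injective f hf.1 _)

/-- Zero is a transfer from the empty set. The dependent product of the empty set along `f` is
empty, as no section exists over a nonempty fibre, so distributivity writes the norm as a transfer
from the empty set. -/
theorem nm_zero_of_surjective (f : X →[G] Y) (hf : Function.Surjective f) : R.nm f 0 = 0 := by
  have h : IsExponentialDiagram (fromEmpty G X) f (MulActionHom.id G) (MulActionHom.id G)
      (fromEmpty G Y) := by
    refine ⟨⟨fun t => t.elim, fun x b => b.elim⟩, fun y s hs => ?_⟩
    obtain ⟨x, hx⟩ := hf y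
    exact (s ⟨x, hx⟩).elim
  have := R.nm_tr h 0
  rw [map_zero] at this
  rw [this, Subsingleton.elim (R.nm _ _) 0, map_zero]

/-- Frobenius reciprocity. -/
theorem tr_mul_res (f : X →[G] Y) (a : R.obj X) (b : R.obj Y) :
    R.tr f (a * R.res f b) = R.tr f a * b := by
  let iX : X →[G] (X ⊕ Y) := gMap Sum.inl fun _ _ => rfl
  let jY : Y →[G] (X ⊕ Y) := gMap Sum.inr fun _ _ => rfl
  let iY : Y →[G] (Y ⊕ Y) := gMap Sum.inl fun _ _ => rfl
  let jY' : Y →[G] (Y ⊕ Y) := gMap Sum.inr fun _ _ => rfl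
  let iX' : X →[G] (X ⊕ X) := gMap Sum.inl fun _ _ => rfl
  let jX' : X →[G] (X ⊕ X) := gMap Sum.inr fun _ _ => rfl
  let p : (X ⊕ Y) →[G] (Y ⊕ Y) := gMap (Sum.map f id) (by
    rintro g (x | y)
    · exact congrArg Sum.inl (map_smul f g x)
    · rfl)
  let e : (X ⊕ X) →[G] (X ⊕ Y) := gMap (Sum.map id f) (by
    rintro g (x | y)
    · rfl
    · exact congrArg Sum.inr (map_smul f g y))
  let nY : (Y ⊕ Y) →[G] Y := gMap (Sum.elim id id) (by rintro g (x | y) <;> rfl)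
  let nX : (X ⊕ X) →[G] X := gMap (Sum.elim id id) (by rintro g (x | y) <;> rfl)
  have hsum : ∀ {A B : Type u}, Function.Bijective (Sum.elim Sum.inl Sum.inr : A ⊕ B → A ⊕ B) := by
    intro A B
    rw [Sum.elim_inl_inr]
    exact Function.bijective_id
  -- Norm along a fold map is multiplication. A section of `f ⊔ id` over the two copies of `y` is a
  -- point of `X` above `y`, so distributivity for this diagram is the desired formula.
  have hexp : IsExponentialDiagram p nY e nX f := by
    refine ⟨⟨?_, ?_⟩, ?_⟩
    · rintro (x | x) <;> rfl
    · rintro (y | y) x (h : y = f x)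
      · refine ⟨Sum.inl x, ⟨congrArg Sum.inl h.symm, rfl⟩, ?_⟩
        rintro (t | t) ⟨h1, h2⟩
        · exact congrArg Sum.inl h2
        · exact (Sum.inr_ne_inl h1).elim
      · refine ⟨Sum.inr x, ⟨congrArg Sum.inr h.symm, rfl⟩, ?_⟩
        rintro (t | t) ⟨h1, h2⟩
        · exact (Sum.inl_ne_inr h1).elim
        · exact congrArg Sum.inr h2
    · intro y s hs
      obtain ⟨x, hx⟩ : ∃ x, s ⟨Sum.inl y, rfl⟩ = Sum.inl x := by
        have := hs ⟨Sum.inl y, rfl⟩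
        rcases h : s ⟨Sum.inl y, rfl⟩ with x | x
        · exact ⟨x, rfl⟩
        · rw [h] at this
          exact (Sum.inr_ne_inl this).elim
      have hx' : f x = y := by
        have := hs ⟨Sum.inl y, rfl⟩
        rw [hx] at this
        exact Sum.inl_injective this
      have hy : s ⟨Sum.inr y, rfl⟩ = Sum.inr y := by
        have := hs ⟨Sum.inr y, rfl⟩
        rcases h : s ⟨Sum.inr y, rfl⟩ with x | x
        · rw [h] at this
          exact (Sum.inl_ne_inr this).elim
        · exact congrArg Sum.inr (Sum.inr_injective ((congrArg p h).symm.trans this))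
      refine ⟨x, ⟨hx', ?_⟩, ?_⟩
      · rintro (t | t) ⟨y' | y', h⟩ h1 h2
        · obtain rfl : y' = y := h
          rw [hx]
          exact congrArg Sum.inl h1
        · exact (Sum.inl_ne_inr h2).elim
        · exact (Sum.inr_ne_inl h2).elim
        · obtain rfl : y' = y := h
          rw [hy]
          exact congrArg Sum.inr (Sum.inr_injective h2)
      · intro x' ⟨h1, h2⟩
        have := h2 (Sum.inl x') ⟨Sum.inl y, rfl⟩ rfl (congrArg Sum.inl h1)
        rw [hx] at this
        exact Sum.inl_injective this
  obtain ⟨c, hc⟩ := (R.bijective_of_sum iX jY hsum).2 (a, b)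
  obtain ⟨hca, hcb⟩ := Prod.mk.inj hc
  have h := R.nm_tr hexp c
  have e1 : R.res iY (R.tr p c) = R.tr f a := by
    have hp : IsPullbackSquare iX f p iY := by
      refine ⟨fun _ => rfl, ?_⟩
      rintro (x | x) y hxy
      · exact ⟨x, ⟨rfl, Sum.inl_injective hxy⟩, fun t ht => Sum.inl_injective ht.1⟩
      · exact (Sum.inr_ne_inl hxy).elim
    rw [R.res_tr hp, hca]
  have e2 : R.res jY' (R.tr p c) = b := by
    have hp : IsPullbackSquare jY (MulActionHom.id G) p jY' := by
      refine ⟨fun _ => rfl, ?_⟩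
      rintro (x | x) y hxy
      · exact (Sum.inl_ne_inr hxy).elim
      · exact ⟨x, ⟨rfl, Sum.inr_injective hxy⟩, fun t ht => Sum.inr_injective ht.1⟩
    rw [R.res_tr hp, hcb, R.tr_id]
  have e3 : R.res iX' (R.res e c) = a := by
    rw [← R.res_comp, ← hca]; rfl
  have e4 : R.res jX' (R.res e c) = R.res f b := by
    rw [← R.res_comp, ← hcb, ← R.res_comp]; rfl
  rw [R.nm_eq_mul (i := iY) (j := jY') hsum, R.nm_eq_mul (i := iX') (j := jX') hsum, e1, e2, e3,
    e4] at h
  rw [show nY.comp iY = MulActionHom.id G from rfl, show nY.comp jY' = MulActionHom.id G from rfl,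
    show nX.comp iX' = MulActionHom.id G from rfl, show nX.comp jX' = MulActionHom.id G from rfl,
    R.nm_id, R.nm_id, R.nm_id, R.nm_id] at h
  exact h.symm

end Basic

/-! ### Detecting elements on orbits, and at points of free `G`-sets. -/

section Detection

variable {G : Type u} [Group G] [Finite G] (R : TambaraFunctor.{u, v} G)
variable {X Y Z : Type u} [MulAction G X] [Finite X] [MulAction G Y] [Finite Y]
  [MulAction G Z] [Finite Z]

/-- Elements are determined by their restrictions to orbits. -/
theorem ext_orbits {a b : R.obj X}
    (h : ∀ (H : Subgroup G) (f : (G ⧸ H) →[G] X), R.res f a = R.res f b) : a = b := by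
  refine orbit_induction (G := G) (P := fun X _ _ => ∀ a b : R.obj X,
    (∀ (H : Subgroup G) (f : (G ⧸ H) →[G] X), R.res f a = R.res f b) → a = b)
    ?_ ?_ X a b h
  · intro X _ _ _ a b _
    exact Subsingleton.elim a b
  · intro X Y _ _ _ _ H _ i j hij ih a b h
    refine R.ext_sum hij (h H i) (ih _ _ fun K f => ?_)
    rw [← R.res_comp, ← R.res_comp, h]

/-- The value of an element of `R(X)` at a point of `X`. -/
def ev (x : X) : R.obj X →+* R.level ⊥ := R.res (pt x)

theorem ev_apply (x : X) (a : R.obj X) : R.ev x a = R.res (pt x) a := rfl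

theorem ev_res (f : X →[G] Y) (x : X) (a : R.obj Y) : R.ev x (R.res f a) = R.ev (f x) a := by
  rw [ev_apply, ev_apply, ← R.res_comp, comp_pt]

theorem ev_smul (g : G) (x : X) (a : R.obj X) : R.ev (g • x) a = R.conj g (R.ev x a) := by
  rw [ev_apply, pt_smul, R.res_comp]
  rfl

/-- Elements over a free `G`-set are determined by their values at points. -/
theorem ext_free (hX : ∀ (g : G) (x : X), g • x = x → g = 1) {a b : R.obj X}
    (h : ∀ x, R.ev x a = R.ev x b) : a = b := by
  refine R.ext_orbits fun H f => ?_
  obtain rfl : H = ⊥ := by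
    refine (Subgroup.eq_bot_iff_forall H).2 fun g hg => hX g (f ((1 : G) : G ⧸ H)) ?_
    rw [← map_smul]
    refine congrArg f (QuotientGroup.eq.2 ?_)
    simpa using H.inv_mem hg
  have : f = pt (f ((1 : G) : G ⧸ (⊥ : Subgroup G))) := hom_ext_one (by rw [pt_one])
  rw [this]
  exact h _

theorem ext_prod {a b : R.obj ((G ⧸ (⊥ : Subgroup G)) × X)} (h : ∀ x, R.ev x a = R.ev x b) :
    a = b :=
  R.ext_free (fun _ _ h => smul_bot_eq_self (Prod.ext_iff.1 h).1) h

/-- Every orbit over `G/e` maps bijectively to it, so `W` is a disjoint union of `n` copies of `G/e`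
and the norm multiplies `n` copies of `d`. -/
theorem nm_res_orbit {W : Type u} [MulAction G W] [Finite W] (f : W →[G] (G ⧸ (⊥ : Subgroup G)))
    (d : R.level ⊥) : ∃ n : ℕ, (IsEmpty W ∨ 0 < n) ∧ R.nm f (R.res f d) = d ^ n := by
  refine orbit_induction (G := G) (P := fun W _ _ => ∀ (f : W →[G] (G ⧸ (⊥ : Subgroup G))),
    ∃ n : ℕ, (IsEmpty W ∨ 0 < n) ∧ R.nm f (R.res f d) = d ^ n) ?_ ?_ W f
  · intro X _ _ _ f
    exact ⟨0, Or.inl inferInstance, by rw [Subsingleton.elim (R.res f d) 1, map_one, pow_zero]⟩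
  · intro X Y _ _ _ _ H _ i j hij ih f
    obtain ⟨n, -, hn⟩ := ih (f.comp j)
    refine ⟨n + 1, Or.inr n.succ_pos, ?_⟩
    have hb : Function.Bijective (f.comp i) := by
      refine ⟨fun a b hab => ?_, orbit_hom_surjective _⟩
      obtain ⟨g, rfl⟩ := coset_eq_smul_one a
      obtain ⟨k, rfl⟩ := coset_eq_smul_one b
      rw [map_smul, map_smul, ← inv_smul_eq_iff, smul_smul] at hab
      have := smul_bot_eq_self hab
      rw [inv_mul_eq_one] at this
      rw [this]
    rw [R.nm_eq_mul hij, ← R.res_comp, ← R.res_comp, R.nm_res_of_bijective _ hb, hn, pow_succ']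

end Detection

end TambaraFunctor

namespace TambaraFunctor

/-! ### Products with `G/e` and the dependent product of `T` along `G/e → pt`. -/

section FreeSets

variable {G : Type u} [Group G]

variable (G) in
/-- The free orbit `G/e`. -/
abbrev FreeOrbit : Type u := G ⧸ (⊥ : Subgroup G)

/-- The map `id × f` on products with `G/e`. -/
def freeMap {X Y : Type u} [MulAction G X] [MulAction G Y] (f : X →[G] Y) :
    (FreeOrbit G × X) →[G] (FreeOrbit G × Y) :=
  gMap (fun x => (x.1, f x.2)) fun g x => Prod.ext rfl (map_smul f g x.2)

variable (G) in
/-- The projection `G/e × X → X`. -/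
def freeProj (X : Type u) [MulAction G X] : (FreeOrbit G × X) →[G] X :=
  gMap Prod.snd fun _ _ => rfl

theorem freeProj_surjective (X : Type u) [MulAction G X] : Function.Surjective (freeProj G X) :=
  fun x => ⟨(((1 : G) : FreeOrbit G), x), rfl⟩

theorem isPullbackSquare_free {X Y : Type u} [MulAction G X] [MulAction G Y] (f : X →[G] Y) :
    IsPullbackSquare (freeMap f) (freeProj G X) (freeProj G Y) f := by
  refine ⟨fun _ => rfl, fun x b h => ⟨(x.1, b), ⟨Prod.ext rfl h.symm, rfl⟩, ?_⟩⟩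
  rintro t ⟨rfl, rfl⟩
  rfl

/-- The `G`-set of maps of sets `G/e → T`, with the conjugation action. -/
@[ext]
structure FreeFun (G : Type u) [Group G] (T : Type u) where
  toFun : FreeOrbit G → T

instance {T : Type u} [MulAction G T] : MulAction G (FreeFun G T) where
  smul g φ := ⟨fun x => g • φ.toFun (g⁻¹ • x)⟩
  one_smul φ := by
    ext x
    change (1 : G) • φ.toFun ((1 : G)⁻¹ • x) = φ.toFun x
    rw [inv_one, one_smul, one_smul]
  mul_smul g h φ := by
    ext x
    change (g * h) • φ.toFun ((g * h)⁻¹ • x) = g • h • φ.toFun (h⁻¹ • g⁻¹ • x)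
    rw [mul_inv_rev, mul_smul, mul_smul]

theorem FreeFun.smul_apply_smul {T : Type u} [MulAction G T] (g : G) (φ : FreeFun G T)
    (x : FreeOrbit G) : (g • φ).toFun (g • x) = g • φ.toFun x := by
  change g • φ.toFun (g⁻¹ • g • x) = _
  rw [inv_smul_smul]

instance [Finite G] {T : Type u} [Finite T] : Finite (FreeFun G T) :=
  Finite.of_injective FreeFun.toFun fun _ _ h => FreeFun.ext h

variable (G) in
/-- The map to the point. -/
def toPoint (X : Type u) [MulAction G X] : X →[G] PUnit.{u + 1} := gMap (fun _ => PUnit.unit)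
  fun _ _ => rfl

/-- Evaluation of functions on `G/e`. -/
def evalMap {T : Type u} [MulAction G T] : (FreeOrbit G × FreeFun G T) →[G] (FreeOrbit G × T) :=
  gMap (fun x => (x.1, x.2.toFun x.1)) fun g x =>
    Prod.ext rfl (FreeFun.smul_apply_smul g x.2 x.1)

variable {T : Type u} [MulAction G T]

theorem isExponentialDiagram_freeFun : IsExponentialDiagram
    (gMap Prod.fst fun _ _ => rfl : (FreeOrbit G × T) →[G] FreeOrbit G) (toPoint G (FreeOrbit G))
    evalMap (freeProj G (FreeFun G T)) (toPoint G (FreeFun G T)) := by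
  refine ⟨⟨fun _ => rfl, fun x b _ => ⟨(x, b), ⟨rfl, rfl⟩, ?_⟩⟩, fun y s hs => ?_⟩
  · rintro t ⟨h1, h2⟩
    exact Prod.ext h1 h2
  · refine ⟨⟨fun x => (s ⟨x, rfl⟩).2⟩, ⟨rfl, ?_⟩, ?_⟩
    · rintro ⟨t, b⟩ ⟨x, hx⟩ rfl h2
      obtain rfl : t = x := h2
      exact Prod.ext (hs ⟨t, hx⟩).symm rfl
    · rintro b ⟨-, hb⟩
      ext x
      exact congrArg Prod.snd (hb (x, b) ⟨x, rfl⟩ rfl rfl)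

end FreeSets

/-! ### The idempotent `tau` obtained by norming an equivariant system of idempotents. -/

section TautologicalIdempotent

variable {G : Type u} [Group G] [Finite G] (R : TambaraFunctor.{u, v} G)

theorem conj_one (a : R.level ⊥) : R.conj 1 a = a := by
  have : rightMul (1 : G) = MulActionHom.id G := by
    ext x
    exact mul_one x
  rw [conj, this, R.res_id]

theorem conj_mul (g h : G) (a : R.level ⊥) : R.conj (g * h) a = R.conj g (R.conj h a) := by
  have : rightMul (g * h) = (rightMul h).comp (rightMul g) := by
    ext x
    exact (mul_assoc x (g : FreeOrbit G) (h : FreeOrbit G)).symm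
  rw [conj, this, R.res_comp]
  rfl

/-- A complete orthogonal system of idempotents of `R(G/e)`, indexed equivariantly by a finite
`G`-set. -/
structure EquivariantIdempotents (T : Type u) [MulAction G T] [Fintype T] where
  toFun : T → R.level ⊥
  map_smul : ∀ (g : G) (t : T), toFun (g • t) = R.conj g (toFun t)
  idem : ∀ t, toFun t * toFun t = toFun t
  orth : ∀ s t, s ≠ t → toFun s * toFun t = 0
  sum_eq_one : ∑ t, toFun t = 1

namespace EquivariantIdempotents

variable {R} {T : Type u} [MulAction G T] [Fintype T] (d : R.EquivariantIdempotents T)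

/-- The graph of `pt t`. -/
def graph (t : T) : FreeOrbit G →[G] (FreeOrbit G × T) :=
  gMap (fun x => (x, pt t x)) fun g x => Prod.ext rfl (_root_.map_smul (pt t) g x)

/-- The element of `R(G/e × T)` with values `d t`. -/
def delta : R.obj (FreeOrbit G × T) := ∑ t, R.tr (graph t) (d.toFun t)

/-- The graphs of the maps `pt t` partition `G/e × T`. Only the graph through `(g, t')`, that of
`g⁻¹ • t'`, contributes, and equivariance of `d` turns its value into `d t'`. -/
theorem ev_delta (x : FreeOrbit G × T) : R.ev x d.delta = d.toFun x.2 := by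
  obtain ⟨x, t'⟩ := x
  obtain ⟨g, rfl⟩ := coset_eq_smul_one x
  rw [delta, map_sum, Finset.sum_eq_single (g⁻¹ • t')]
  · have h : pt (g • ((1 : G) : FreeOrbit G), t') = (graph (g⁻¹ • t')).comp (rightMul g) := by
      refine hom_ext_one ?_
      rw [pt_one]
      have h1 : rightMul g ((1 : G) : FreeOrbit G) = g • ((1 : G) : FreeOrbit G) :=
        congrArg _ ((one_mul g).trans (mul_one g).symm)
      refine Prod.ext h1.symm ?_
      change t' = pt (g⁻¹ • t') (rightMul g ((1 : G) : FreeOrbit G))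
      rw [h1, _root_.map_smul, pt_one, smul_inv_smul]
    rw [ev_apply, h, R.res_comp, R.res_tr_of_injective _ fun a b hab => congrArg Prod.fst hab]
    exact (d.map_smul _ _).symm.trans (by rw [smul_inv_smul])
  · intro t _ ht
    refine R.res_tr_of_disjoint _ _ (fun x y hxy => ht ?_) _
    obtain ⟨k, rfl⟩ := coset_eq_smul_one y
    rw [_root_.map_smul, pt_one] at hxy
    have h1 : x = k • g • ((1 : G) : FreeOrbit G) := congrArg Prod.fst hxy
    have h2 : pt t x = k • t' := congrArg Prod.snd hxy
    rw [h1, _root_.map_smul, _root_.map_smul, pt_one] at h2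
    rw [← MulAction.injective k h2, inv_smul_smul]
  · exact fun h => (h (Finset.mem_univ _)).elim

theorem delta_idem : d.delta * d.delta = d.delta :=
  R.ext_prod fun x => by rw [map_mul, ev_delta, d.idem]

/-- The tautological idempotent of `R(T)`, the norm of `delta`. -/
def tau : R.obj T := R.nm (freeProj G T) d.delta

theorem tau_idem : d.tau * d.tau = d.tau := by
  rw [tau, ← map_mul, delta_idem]

variable {X Y : Type u} [MulAction G X] [Finite X] [MulAction G Y] [Finite Y]

theorem res_tau (a : X →[G] T) :
    R.res a d.tau = R.nm (freeProj G X) (R.res (freeMap a) d.delta) :=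
  R.res_nm (isPullbackSquare_free a) _

theorem res_tau_mul_res_tau (a b : X →[G] T) (h : ∀ x, a x ≠ b x) :
    R.res a d.tau * R.res b d.tau = 0 := by
  rw [res_tau, res_tau, ← map_mul]
  convert R.nm_zero_of_surjective _ (freeProj_surjective X)
  refine R.ext_prod fun x => ?_
  rw [map_mul, ev_res, ev_res, ev_delta, ev_delta, map_zero]
  exact d.orth _ _ (h x.2)

/-- This lets norms descend to the corner rings. Both factors are norms from `G/e × Y`, where the
claim can be checked at points: there it reads `E * E ^ n = E` for an idempotent `E`, also when the
fibre is empty and `n = 0`. -/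
theorem res_tau_mul_nm (f : X →[G] Y) (y : Y →[G] T) :
    R.res y d.tau * R.nm f (R.res (y.comp f) d.tau) = R.res y d.tau := by
  rw [res_tau, res_tau, ← R.nm_comp]
  have h : f.comp (freeProj G X) = (freeProj G Y).comp (freeMap f) := rfl
  have h' : freeMap (y.comp f) = (freeMap y).comp (freeMap f) := rfl
  rw [h, R.nm_comp, ← map_mul, h', R.res_comp]
  congr 1
  generalize hD : R.res (freeMap y) d.delta = D
  have hDD : D * D = D := by rw [← hD, ← map_mul, delta_idem]
  refine R.ext_prod fun p => ?_
  rw [map_mul]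
  let W := {q : FreeOrbit G × (FreeOrbit G × X) // freeMap f q.2 = pt p q.1}
  let : MulAction G W := subMulAction _ fun g q hq => by
    change freeMap f (g • q.2) = pt p (g • q.1)
    rw [_root_.map_smul, _root_.map_smul, hq]
  have hW : IsPullbackSquare (gMap (fun w : W => w.1.2) fun _ _ => rfl)
      (gMap (fun w : W => w.1.1) fun _ _ => rfl) (freeMap f) (pt p) := by
    refine ⟨fun w => w.2, fun x b h => ⟨⟨(b, x), h⟩, ⟨rfl, rfl⟩, ?_⟩⟩
    rintro w ⟨rfl, rfl⟩
    rfl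
  have hcomp : (freeMap f).comp (gMap (fun w : W => w.1.2) fun _ _ => rfl) =
      (pt p).comp (gMap (fun w : W => w.1.1) fun _ _ => rfl) := by
    ext w : 1
    exact w.2
  rw [ev_apply, ev_apply, R.res_nm hW, ← R.res_comp, hcomp, R.res_comp]
  obtain ⟨n, -, hn⟩ := R.nm_res_orbit (gMap (fun w : W => w.1.1) fun _ _ => rfl)
    (R.res (pt p) D)
  have hE : IsIdempotentElem (R.res (pt p) D) := by
    rw [IsIdempotentElem, ← map_mul, hDD]
  rw [hn, ← pow_succ', hE.pow_succ_eq]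

/-- Over `pt t`, `delta` is the pullback of `d t` from `G/e`, so the value of `tau` at `t` is a
positive power of `d t`. This ties the components to the given idempotents. -/
theorem ev_tau_mul (t : T) : R.ev t d.tau * d.toFun t = R.ev t d.tau := by
  rw [ev_apply, res_tau]
  have h : R.res (freeMap (pt t)) d.delta = R.res (freeProj G (FreeOrbit G)) (d.toFun t) := by
    refine R.ext_prod fun x => ?_
    obtain ⟨x, y⟩ := x
    obtain ⟨g, rfl⟩ := coset_eq_smul_one y
    rw [ev_res, ev_res, ev_delta]
    change d.toFun (pt t (g • ((1 : G) : FreeOrbit G))) = R.ev (g • ((1 : G) : FreeOrbit G)) _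
    rw [_root_.map_smul, pt_one, d.map_smul, ev_smul, ev_apply]
    have : pt ((1 : G) : FreeOrbit G) = MulActionHom.id G := hom_ext_one (pt_one _)
    rw [this, R.res_id]
  obtain ⟨n, hn, h'⟩ := R.nm_res_orbit (freeProj G (FreeOrbit G)) (d.toFun t)
  rw [h, h']
  have hE : IsIdempotentElem (d.toFun t) := d.idem t
  rcases hn with hn | hn
  · exact (hn.false (((1 : G) : FreeOrbit G), ((1 : G) : FreeOrbit G))).elim
  · rw [← pow_succ, hE.pow_succ_eq]
    exact (hE.pow_eq hn.ne').symm

theorem tr_delta : R.tr (gMap Prod.fst fun _ _ => rfl : (FreeOrbit G × T) →[G] FreeOrbit G) d.delta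
    = 1 := by
  rw [delta, map_sum, ← d.sum_eq_one]
  refine Finset.sum_congr rfl fun t _ => ?_
  rw [← R.tr_comp]
  exact R.tr_id _ _

theorem tr_tau : R.tr (toPoint G T) d.tau = 1 := by
  have key := R.nm_tr (isExponentialDiagram_freeFun (G := G) (T := T)) d.delta
  rw [tr_delta, map_one] at key
  let p : FreeFun G T → Prop := fun φ => ∃ x y, φ.toFun x ≠ φ.toFun y
  let : MulAction G {φ // p φ} := subMulAction p fun g φ ⟨x, y, h⟩ =>
    ⟨g • x, g • y, by
      rw [FreeFun.smul_apply_smul, FreeFun.smul_apply_smul]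
      exact (MulAction.injective g).ne h⟩
  -- The functions `G/e → T` split into the constant ones, a copy of `T`, and the nonconstant ones.
  let i : T →[G] FreeFun G T := gMap (fun t => ⟨fun _ => t⟩) fun _ _ => rfl
  let j : {φ // p φ} →[G] FreeFun G T := gMap Subtype.val fun _ _ => rfl
  have hij : Function.Bijective (Sum.elim i j) := by
    constructor
    · rintro (a | a) (b | b) h
      · exact congrArg Sum.inl (congrFun (congrArg FreeFun.toFun h) ((1 : G) : FreeOrbit G))
      · obtain ⟨b, x, y, hb⟩ := b
        obtain rfl : i a = b := h
        exact (hb rfl).elim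
      · obtain ⟨a, x, y, ha⟩ := a
        obtain rfl : a = i b := h
        exact (ha rfl).elim
      · exact congrArg Sum.inr (Subtype.ext h)
    · intro φ
      by_cases h : p φ
      · exact ⟨Sum.inr ⟨φ, h⟩, rfl⟩
      · refine ⟨Sum.inl (φ.toFun ((1 : G) : FreeOrbit G)), ?_⟩
        ext x
        by_contra h'
        exact h ⟨_, _, h'⟩
  rw [R.tr_eq_add hij, R.res_nm (isPullbackSquare_free i), R.res_nm (isPullbackSquare_free j),
    ← R.res_comp, ← R.res_comp] at key
  have h1 : evalMap.comp (freeMap i) = MulActionHom.id G := rfl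
  rw [h1, R.res_id] at key
  -- The norm of `y` is unchanged by right translations of `G/e`. The product of all translates of
  -- `y` vanishes, since at a nonconstant `φ` it contains two orthogonal factors. So the norm to the
  -- power `|G|` is the norm of zero, and an idempotent with a vanishing power is zero.
  have h2 : R.nm (freeProj G {φ // p φ}) (R.res (evalMap.comp (freeMap j)) d.delta) = 0 := by
    generalize hy : R.res (evalMap.comp (freeMap j)) d.delta = y
    have hev : ∀ x, R.ev x y = d.toFun (x.2.1.toFun x.1) := fun x => by
      rw [← hy, ev_res, ev_delta]
      rfl
    have hyy : IsIdempotentElem y := by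
      rw [IsIdempotentElem, ← hy, ← map_mul, delta_idem]
    let r : G → (FreeOrbit G × {φ // p φ}) →[G] (FreeOrbit G × {φ // p φ}) := fun g =>
      gMap (fun x => (rightMul g x.1, x.2)) fun k x => Prod.ext (_root_.map_smul _ _ _) rfl
    have hr : ∀ g, Function.Bijective (r g) := fun g => by
      refine Finite.injective_iff_bijective.1 fun a b hab => ?_
      obtain ⟨h1, h2⟩ := Prod.mk.inj hab
      exact Prod.ext (mul_right_cancel h1) h2
    have hn : ∀ g, R.nm (freeProj G {φ // p φ}) (R.res (r g) y) =
        R.nm (freeProj G {φ // p φ}) y := fun g => by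
      have : freeProj G {φ // p φ} = (freeProj G {φ // p φ}).comp (r g) := rfl
      conv_lhs => rw [this]
      rw [R.nm_comp, R.nm_res_of_bijective _ (hr g)]
    have := Fintype.ofFinite G
    have hprod : ∏ g, R.res (r g) y = 0 := by
      refine R.ext_prod fun x => ?_
      rw [map_prod, map_zero]
      obtain ⟨x, φ, a, b, hab⟩ := x
      have hex : ∀ a : FreeOrbit G, ∃ g : G, rightMul g x = a := fun a => by
        obtain ⟨k, hk⟩ := QuotientGroup.mk_surjective (x⁻¹ * a)
        refine ⟨k, ?_⟩
        change x * (k : FreeOrbit G) = a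
        rw [hk, mul_inv_cancel_left]
      obtain ⟨g, hg⟩ := hex a
      obtain ⟨k, hk⟩ := hex b
      have hgk : g ≠ k := by
        rintro rfl
        exact hab (by rw [← hg, ← hk])
      classical
      rw [← Finset.mul_prod_erase _ _ (Finset.mem_univ g), ← Finset.mul_prod_erase _ _
        (Finset.mem_erase.2 ⟨hgk.symm, Finset.mem_univ k⟩), ← mul_assoc, ev_res, ev_res, hev, hev]
      change d.toFun (φ.toFun (rightMul g x)) * d.toFun (φ.toFun (rightMul k x)) * _ = 0
      rw [hg, hk, d.orth _ _ hab, zero_mul]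
    have hpow : R.nm (freeProj G {φ // p φ}) y ^ Fintype.card G = 0 := by
      rw [← R.nm_zero_of_surjective _ (freeProj_surjective (G := G) {φ // p φ}), ← hprod, map_prod,
        Finset.prod_congr rfl fun g _ => hn g, Finset.prod_const, Finset.card_univ]
    have hidem : IsIdempotentElem (R.nm (freeProj G {φ // p φ}) y) := by
      rw [IsIdempotentElem, ← map_mul, hyy.eq]
    rw [← hpow, hidem.pow_eq Fintype.card_ne_zero]
  rw [h2, map_zero, add_zero] at key
  exact key.symm

/-- The partition of unity obtained by transfer along `X × T → X`. -/
theorem tr_res_tau (X : Type u) [MulAction G X] [Finite X] :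
    R.tr (gMap Prod.fst fun _ _ => rfl : (X × T) →[G] X)
      (R.res (gMap Prod.snd fun _ _ => rfl : (X × T) →[G] T) d.tau) = 1 := by
  have h : IsPullbackSquare (gMap Prod.snd fun _ _ => rfl : (X × T) →[G] T)
      (gMap Prod.fst fun _ _ => rfl : (X × T) →[G] X) (toPoint G T) (toPoint G X) := by
    refine ⟨fun _ => rfl, fun x b _ => ⟨(b, x), ⟨rfl, rfl⟩, ?_⟩⟩
    rintro t ⟨h1, h2⟩
    exact Prod.ext h2 h1
  rw [← R.res_tr h, tr_tau, map_one]

end EquivariantIdempotents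

end TautologicalIdempotent

end TambaraFunctor

/-! ### Induced `G`-sets. -/

/-- The induced `G`-set `G ×_H Y`, as the set `G/H × Y` with the action twisted by the cocycle of
the chosen section of `G → G/H`. -/
@[ext]
structure Induced {G : Type u} [Group G] (H : Subgroup G) (Y : Type u) where
  coset : G ⧸ H
  point : Y

namespace Induced

variable {G : Type u} [Group G] {H : Subgroup G}

theorem smul_mk_out (g : G) (c : G ⧸ H) : ((g * c.out : G) : G ⧸ H) = g • c := by
  rw [← smul_eq_mul, ← MulAction.Quotient.smul_coe, QuotientGroup.out_eq']

/-- The cocycle of the chosen section of `G → G/H`. -/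
noncomputable def cocycle (g : G) (c : G ⧸ H) : H :=
  ⟨(g • c).out⁻¹ * (g * c.out), QuotientGroup.eq.1 (by rw [QuotientGroup.out_eq', smul_mk_out])⟩

theorem cocycle_one (c : G ⧸ H) : cocycle 1 c = 1 := by
  refine Subtype.ext ?_
  simp only [cocycle, one_smul, one_mul, inv_mul_cancel, Subgroup.coe_one]

theorem cocycle_mul (g h : G) (c : G ⧸ H) :
    cocycle (g * h) c = cocycle g (h • c) * cocycle h c := by
  refine Subtype.ext ?_
  simp only [cocycle, Subgroup.coe_mul, mul_smul]
  group

variable {X Y Z : Type u} [MulAction H X] [MulAction H Y] [MulAction H Z]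

noncomputable instance : MulAction G (Induced H Y) where
  smul g p := ⟨g • p.coset, cocycle g p.coset • p.point⟩
  one_smul p := by
    refine Induced.ext (one_smul G p.coset) ?_
    change cocycle 1 p.coset • p.point = p.point
    rw [cocycle_one, one_smul]
  mul_smul g h p := by
    refine Induced.ext (mul_smul g h p.coset) ?_
    change cocycle (g * h) p.coset • p.point = cocycle g (h • p.coset) • cocycle h p.coset • p.point
    rw [cocycle_mul, mul_smul]

instance [Finite G] [Finite Y] : Finite (Induced H Y) :=
  Finite.of_injective (fun p : Induced H Y => (p.coset, p.point)) fun _ _ h =>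
    Induced.ext (congrArg Prod.fst h) (congrArg Prod.snd h)

open TambaraFunctor

/-- Induction of maps. -/
noncomputable def map (H : Subgroup G) {X Y : Type u} [MulAction H X] [MulAction H Y] (f : X →[H] Y) :
    Induced H X →[G] Induced H Y :=
  gMap (fun p => ⟨p.coset, f p.point⟩) fun _ _ => Induced.ext rfl (map_smul f _ _)

/-- The projection of an induced `G`-set to `G/H`. -/
noncomputable def proj (H : Subgroup G) (Y : Type u) [MulAction H Y] : Induced H Y →[G] (G ⧸ H) :=
  gMap coset fun _ _ => rfl

theorem map_injective {f : X →[H] Y} (hf : Function.Injective f) : Function.Injective (map H f) :=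
  fun _ _ h => Induced.ext (Induced.ext_iff.1 h).1 (hf (Induced.ext_iff.1 h).2)

theorem map_surjective {f : X →[H] Y} (hf : Function.Surjective f) :
    Function.Surjective (map H f) := fun p => by
  obtain ⟨x, hx⟩ := hf p.point
  exact ⟨⟨p.coset, x⟩, Induced.ext rfl hx⟩

theorem isPullbackSquare_map {E B : Type u} [MulAction H E] [MulAction H B] {u : E →[H] X}
    {v : E →[H] B} {f : X →[H] Y} {q : B →[H] Y} (h : IsPullbackSquare u v f q) :
    IsPullbackSquare (map H u) (map H v) (map H f) (map H q) := by
  refine ⟨fun t => Induced.ext rfl (h.comm t.point), fun x b hxb => ?_⟩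
  obtain ⟨t, ⟨h1, h2⟩, h3⟩ := h.existsUnique x.point b.point (congrArg point hxb)
  refine ⟨⟨x.coset, t⟩, ⟨Induced.ext rfl h1, Induced.ext (Induced.ext_iff.1 hxb).1 h2⟩, ?_⟩
  rintro s ⟨rfl, rfl⟩
  exact Induced.ext rfl (h3 s.point ⟨rfl, rfl⟩)

/-- Induced maps preserve the coset, so a section over a fibre of `map H f` stays above one coset
and is a section over a fibre of `f`. -/
theorem isExponentialDiagram_map {A B E : Type u} [MulAction H A] [MulAction H B] [MulAction H E]
    {p : A →[H] X} {f : X →[H] Y} {e : E →[H] A} {f' : E →[H] B} {q : B →[H] Y}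
    (h : IsExponentialDiagram p f e f' q) :
    IsExponentialDiagram (map H p) (map H f) (map H e) (map H f') (map H q) := by
  refine ⟨isPullbackSquare_map h.isPullback, fun y s hs => ?_⟩
  obtain ⟨b, ⟨h1, h2⟩, h3⟩ := h.existsUnique y.point
    (fun x => (s ⟨⟨y.coset, x.1⟩, Induced.ext rfl x.2⟩).point) fun x =>
      congrArg point (hs ⟨⟨y.coset, x.1⟩, Induced.ext rfl x.2⟩)
  refine ⟨⟨y.coset, b⟩, ⟨Induced.ext rfl h1, ?_⟩, ?_⟩
  · rintro t ⟨x, rfl⟩ ht hx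
    have h4 : t.coset = x.coset := congrArg coset ht
    refine Induced.ext (h4.trans (congrArg coset (hs ⟨x, rfl⟩)).symm) ?_
    exact h2 t.point ⟨x.point, rfl⟩ (congrArg point ht) (congrArg point hx)
  · rintro b' ⟨rfl, hb⟩
    refine Induced.ext rfl (h3 b'.point ⟨rfl, fun t x ht hx => ?_⟩)
    exact congrArg point (hb ⟨b'.coset, t⟩ ⟨⟨b'.coset, x.1⟩, Induced.ext rfl x.2⟩
      (Induced.ext rfl ht) (Induced.ext rfl hx))

theorem bijective_map_sum {i : X →[H] Z} {j : Y →[H] Z} (h : Function.Bijective (Sum.elim i j)) :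
    Function.Bijective (Sum.elim (map H i) (map H j)) := by
  constructor
  · rintro (a | a) (b | b) hab
    · exact congrArg Sum.inl (map_injective (sum_injective_left h) hab)
    · exact (sum_disjoint h _ _ (congrArg point hab)).elim
    · exact (sum_disjoint h _ _ (congrArg point hab).symm).elim
    · exact congrArg Sum.inr (map_injective (sum_injective_right h) hab)
  · intro z
    obtain ⟨x | y, hx⟩ := h.2 z.point
    · exact ⟨Sum.inl ⟨z.coset, x⟩, Induced.ext rfl hx⟩
    · exact ⟨Sum.inr ⟨z.coset, y⟩, Induced.ext rfl hx⟩

/-- The chosen representative of the base coset need not be `1`; `base` corrects for it. -/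
theorem out_one_mem : ((1 : G) : G ⧸ H).out ∈ H := by
  have := QuotientGroup.eq.1 (QuotientGroup.out_eq' ((1 : G) : G ⧸ H)).symm
  rwa [inv_one, one_mul] at this

/-- The inclusion of the fibre over the base point of `G/H`. -/
noncomputable def base (y : Y) : Induced H Y := ⟨((1 : G) : G ⧸ H), (⟨_, out_one_mem⟩ : H)⁻¹ • y⟩

theorem smul_base (h : H) (y : Y) : (h : G) • (base y : Induced H Y) = base (h • y) := by
  have h1 : (h : G) • ((1 : G) : G ⧸ H) = ((1 : G) : G ⧸ H) := by
    rw [MulAction.Quotient.smul_coe, smul_eq_mul, mul_one]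
    exact QuotientGroup.eq.2 (by rw [mul_one]; exact H.inv_mem h.2)
  refine Induced.ext h1 ?_
  change cocycle (h : G) ((1 : G) : G ⧸ H) • (⟨_, out_one_mem⟩ : H)⁻¹ • y =
    (⟨_, out_one_mem⟩ : H)⁻¹ • h • y
  rw [smul_smul, smul_smul]
  congr 1
  refine Subtype.ext ?_
  simp only [cocycle, h1, Subgroup.coe_mul, Subgroup.coe_inv]
  group

theorem out_smul_base (p : Induced H Y) : p.coset.out • base p.point = p := by
  have h1 : p.coset.out • ((1 : G) : G ⧸ H) = p.coset := by
    rw [MulAction.Quotient.smul_coe, smul_eq_mul, mul_one, QuotientGroup.out_eq']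
  refine Induced.ext h1 ?_
  change cocycle p.coset.out ((1 : G) : G ⧸ H) • (⟨_, out_one_mem⟩ : H)⁻¹ • p.point = p.point
  rw [smul_smul]
  convert one_smul H p.point
  refine Subtype.ext ?_
  simp only [cocycle, h1, Subgroup.coe_mul, Subgroup.coe_inv, Subgroup.coe_one]
  group

theorem map_base (f : X →[H] Y) (x : X) : map H f (base x) = base (f x) :=
  Induced.ext rfl (map_smul f _ _)

/-- Extension of an `H`-equivariant map to an induced `G`-set. -/
noncomputable def desc {W : Type u} [MulAction G W] (k : Y → W) (hk : ∀ (h : H) (y : Y), k (h • y) = (h : G) • k y) :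
    Induced H Y →[G] W :=
  gMap (fun p => p.coset.out • k p.point) fun g p => by
    change (g • p.coset).out • k (cocycle g p.coset • p.point) = _
    rw [hk, smul_smul, smul_smul]
    simp only [cocycle]
    rw [mul_inv_cancel_left]

theorem hom_ext_base {W : Type u} [MulAction G W] {f f' : Induced H Y →[G] W}
    (h : ∀ y, f (base y) = f' (base y)) : f = f' := by
  ext p
  rw [← out_smul_base p, _root_.map_smul, _root_.map_smul, h]

section Pullback

variable {W V : Type u} [MulAction G W] [MulAction G V] (g : Induced H Y →[G] W) (f : V →[G] W)

/-- The `H`-set whose induction is the pullback of `f` along a map from an induced `G`-set. -/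
def Fibre : Type u := {t : Y × V // g (base t.1) = f t.2}

instance : MulAction H (Fibre g f) :=
  subMulAction _ fun h t ht => by
    change g (base (h • t.1)) = f ((h : G) • t.2)
    rw [← smul_base, _root_.map_smul, _root_.map_smul, ht]

instance [Finite Y] [Finite V] : Finite (Fibre g f) :=
  inferInstanceAs (Finite {t : Y × V // g (base t.1) = f t.2})

/-- The projection of the fibre to the `H`-set. -/
noncomputable def Fibre.fst : Fibre g f →[H] Y := gMap (fun t => t.1.1) fun _ _ => rfl

/-- The map of `G`-sets from the induced fibre. -/
noncomputable def Fibre.snd : Induced H (Fibre g f) →[G] V := desc (fun t => t.1.2) fun _ _ => rfl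

theorem Fibre.fst_surjective (hf : Function.Surjective f) : Function.Surjective (Fibre.fst g f) :=
  fun y => by
    obtain ⟨x, hx⟩ := hf (g (base y))
    exact ⟨⟨(y, x), hx.symm⟩, rfl⟩

/-- A `G`-set over an induced one is induced from its part over the base coset. Base change along an
arbitrary map from an induced `G`-set thereby becomes an operation of `H`-sets. -/
theorem Fibre.isPullbackSquare : IsPullbackSquare (Fibre.snd g f) (map H (Fibre.fst g f)) f g := by
  refine ⟨fun t => ?_, fun x b h => ?_⟩
  · change f (t.coset.out • t.point.1.2) = g ⟨t.coset, t.point.1.1⟩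
    rw [_root_.map_smul, ← t.point.2, ← _root_.map_smul]
    exact congrArg g (out_smul_base (⟨t.coset, t.point.1.1⟩ : Induced H Y))
  · have hm : g (base b.point) = f (b.coset.out⁻¹ • x) := by
      rw [_root_.map_smul, h, ← _root_.map_smul]
      congr 1
      rw [eq_inv_smul_iff, out_smul_base]
    refine ⟨⟨b.coset, ⟨(b.point, b.coset.out⁻¹ • x), hm⟩⟩, ⟨smul_inv_smul _ _, rfl⟩, ?_⟩
    rintro ⟨c, ⟨⟨y, x'⟩, hy⟩⟩ ⟨rfl, rfl⟩
    refine Induced.ext rfl (Subtype.ext (Prod.ext rfl ?_))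
    exact (inv_smul_smul _ _).symm

end Pullback

end Induced

namespace TambaraFunctor

/-! ### Restriction to a subgroup, corners, and the components `R_H`. -/

section Restrict

variable {G : Type u} [Group G] [Finite G] (R : TambaraFunctor.{u, v} G)

/-- The restriction of a Tambara functor to a subgroup. -/
noncomputable def restrict (H : Subgroup G) : TambaraFunctor.{u, v} H where
  obj X _ _ := R.obj (Induced H X)
  res f := R.res (Induced.map H f)
  tr f := R.tr (Induced.map H f)
  nm f := R.nm (Induced.map H f)
  res_id _ _ _ a := R.res_id _ a
  tr_id _ _ _ a := R.tr_id _ a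
  nm_id _ _ _ a := R.nm_id _ a
  res_comp g f a := R.res_comp (Induced.map H g) (Induced.map H f) a
  tr_comp g f a := R.tr_comp (Induced.map H g) (Induced.map H f) a
  nm_comp g f a := R.nm_comp (Induced.map H g) (Induced.map H f) a
  subsingleton_of_isEmpty X _ _ _ :=
    have : IsEmpty (Induced H X) := ⟨fun p => isEmptyElim p.point⟩
    R.subsingleton_of_isEmpty _
  bijective_of_sum _ _ h := R.bijective_of_sum _ _ (Induced.bijective_map_sum h)
  res_tr h a := R.res_tr (Induced.isPullbackSquare_map h) a
  res_nm h a := R.res_nm (Induced.isPullbackSquare_map h) a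
  nm_tr h a := R.nm_tr (Induced.isExponentialDiagram_map h) a

end Restrict

section Corner

variable {G : Type u} [Group G] (R : TambaraFunctor.{u, v} G)

/-- An idempotent of `R(G/G)`, together with its restrictions, that is compatible with norms. -/
structure NormIdempotent where
  elem (X : Type u) [MulAction G X] [Finite X] : R.obj X
  res_elem {X Y : Type u} [MulAction G X] [Finite X] [MulAction G Y] [Finite Y] (f : X →[G] Y) :
    R.res f (elem Y) = elem X
  idem (X : Type u) [MulAction G X] [Finite X] : IsIdempotentElem (elem X)
  mul_nm_elem {X Y : Type u} [MulAction G X] [Finite X] [MulAction G Y] [Finite Y] (f : X →[G] Y) :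
    elem Y * R.nm f (elem X) = elem Y

namespace NormIdempotent

variable {R} (N : R.NormIdempotent)
variable {X Y : Type u} [MulAction G X] [Finite X] [MulAction G Y] [Finite Y]

/-- An element fixed by the idempotent, as an element of the corner ring. -/
def toCorner (a : R.obj X) (h : N.elem X * a = a) : (N.idem X).Corner :=
  ⟨a, (Subsemigroup.mem_corner_iff (N.idem X)).2 ⟨h, by rw [mul_comm, h]⟩⟩

theorem elem_mul (a : (N.idem X).Corner) : N.elem X * a.1 = a.1 :=
  ((Subsemigroup.mem_corner_iff (N.idem X)).1 a.2).1

theorem elem_mul_tr (f : X →[G] Y) (a : R.obj X) :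
    N.elem Y * R.tr f a = R.tr f (N.elem X * a) := by
  rw [mul_comm, ← R.tr_mul_res, N.res_elem, mul_comm]

theorem elem_mul_nm (f : X →[G] Y) (a : R.obj X) :
    N.elem Y * R.nm f a = N.elem Y * R.nm f (N.elem X * a) := by
  rw [map_mul, ← mul_assoc, N.mul_nm_elem]

/-- The Tambara functor of corner rings of an idempotent. -/
def corner : TambaraFunctor.{u, v} G where
  obj X _ _ := (N.idem X).Corner
  res {X Y} _ _ _ _ f :=
    { toFun := fun a => N.toCorner (R.res f a.1) (by rw [← N.res_elem f, ← map_mul, N.elem_mul])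
      map_one' := Subtype.ext (N.res_elem f)
      map_mul' := fun _ _ => Subtype.ext (map_mul (R.res f) _ _)
      map_zero' := Subtype.ext (map_zero (R.res f))
      map_add' := fun _ _ => Subtype.ext (map_add (R.res f) _ _) }
  tr {X Y} _ _ _ _ f :=
    { toFun := fun a => N.toCorner (R.tr f a.1) (by rw [N.elem_mul_tr, N.elem_mul])
      map_zero' := Subtype.ext (map_zero (R.tr f))
      map_add' := fun _ _ => Subtype.ext (map_add (R.tr f) _ _) }
  -- The norm of `N.elem X` may be larger than `N.elem Y`, so the norm has to be cut down again;
  -- `elem_mul_nm` keeps this functorial.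
  nm {X Y} _ _ _ _ f :=
    { toFun := fun a => N.toCorner (N.elem Y * R.nm f a.1) (by rw [← mul_assoc, (N.idem Y).eq])
      map_one' := Subtype.ext (N.mul_nm_elem f)
      map_mul' := fun a b => Subtype.ext (by
        change N.elem Y * R.nm f (a.1 * b.1) = (N.elem Y * R.nm f a.1) * (N.elem Y * R.nm f b.1)
        rw [map_mul, mul_mul_mul_comm, (N.idem Y).eq]) }
  res_id _ _ _ _ := Subtype.ext (R.res_id _ _)
  tr_id _ _ _ _ := Subtype.ext (R.tr_id _ _)
  nm_id X _ _ a := Subtype.ext (by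
    change N.elem X * R.nm _ a.1 = a.1
    rw [R.nm_id, N.elem_mul])
  res_comp _ _ _ := Subtype.ext (R.res_comp _ _ _)
  tr_comp _ _ _ := Subtype.ext (R.tr_comp _ _ _)
  nm_comp {X Y Z} _ _ _ _ _ _ g f a := Subtype.ext (by
    change N.elem Z * R.nm (g.comp f) a.1 = N.elem Z * R.nm g (N.elem Y * R.nm f a.1)
    rw [← N.elem_mul_nm, R.nm_comp])
  subsingleton_of_isEmpty X _ _ _ := ⟨fun _ _ => Subtype.ext (Subsingleton.elim _ _)⟩
  bijective_of_sum {X Y Z} _ _ _ _ _ _ i j h := by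
    constructor
    · intro a b hab
      obtain ⟨h1, h2⟩ := Prod.mk.inj hab
      exact Subtype.ext (R.ext_sum h (congrArg Subtype.val h1) (congrArg Subtype.val h2))
    · rintro ⟨a, b⟩
      obtain ⟨c, hc⟩ := (R.bijective_of_sum i j h).2 (a.1, b.1)
      obtain ⟨h1, h2⟩ := Prod.mk.inj hc
      refine ⟨N.toCorner c (R.ext_sum h ?_ ?_), Prod.ext (Subtype.ext h1) (Subtype.ext h2)⟩
      · rw [map_mul, N.res_elem, h1, N.elem_mul]
      · rw [map_mul, N.res_elem, h2, N.elem_mul]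
  res_tr h _ := Subtype.ext (R.res_tr h _)
  res_nm {E X B Y} _ _ _ _ _ _ _ _ u v f q h a := Subtype.ext (by
    change R.res q (N.elem Y * R.nm f a.1) = N.elem B * R.nm v (R.res u a.1)
    rw [map_mul, N.res_elem, R.res_nm h])
  nm_tr {X Y A B E} _ _ _ _ _ _ _ _ _ _ p f e f' q h a := Subtype.ext (by
    change N.elem Y * R.nm f (R.tr p a.1) = R.tr q (N.elem B * R.nm f' (R.res e a.1))
    rw [R.nm_tr h, N.elem_mul_tr])

end NormIdempotent

end Corner

section Component

variable {G : Type u} [Group G] [Finite G] {R : TambaraFunctor.{u, v} G}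
variable {T : Type u} [MulAction G T] [Fintype T] (d : R.EquivariantIdempotents T)

/-- The idempotent of the restriction of `R` to `H` given by an orbit `G/H → T`. -/
noncomputable def EquivariantIdempotents.normIdempotent {H : Subgroup G} (t : (G ⧸ H) →[G] T) :
    (R.restrict H).NormIdempotent where
  elem X _ _ := R.res (t.comp (Induced.proj H X)) d.tau
  res_elem f := (R.res_comp (t.comp (Induced.proj H _)) (Induced.map H f) d.tau).symm
  idem X _ _ := by
    change _ * _ = _
    exact (map_mul (R.res _) _ _).symm.trans (congrArg _ d.tau_idem)
  mul_nm_elem f := d.res_tau_mul_nm (Induced.map H f) (t.comp (Induced.proj H _))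

/-- The summand of the restriction of `R` to `H` given by an orbit `G/H → T`. -/
noncomputable def EquivariantIdempotents.component {H : Subgroup G} (t : (G ⧸ H) →[G] T) :
    TambaraFunctor.{u, v} H := (d.normIdempotent t).corner

end Component

end TambaraFunctor

namespace TambaraFunctor

theorem exists_isPullbackSquare {G X Y Z : Type u} [Group G] [MulAction G X] [Finite X]
    [MulAction G Y] [MulAction G Z] [Finite Z] (f : X →[G] Y) (q : Z →[G] Y) : ∃ (E : Type u) (_ : MulAction G E) (_ : Finite E) (u : E →[G] X) (v : E →[G] Z),
      IsPullbackSquare u v f q := by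
  let : MulAction G {t : X × Z // f t.1 = q t.2} := subMulAction _ fun g t ht => by
    change f (g • t.1) = q (g • t.2)
    rw [map_smul, map_smul, ht]
  refine ⟨{t : X × Z // f t.1 = q t.2}, inferInstance, inferInstance,
    gMap (fun t => t.1.1) fun _ _ => rfl, gMap (fun t => t.1.2) fun _ _ => rfl,
    fun t => t.2, fun x z h => ⟨⟨(x, z), h⟩, ⟨rfl, rfl⟩, ?_⟩⟩
  rintro t ⟨rfl, rfl⟩
  rfl

/-! ### Tambara ideals evaluated on all finite `G`-sets. -/

namespace TambaraIdeal

variable {G : Type u} [Group G] [Finite G] {R : TambaraFunctor.{u, v} G}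
variable {X Y : Type u} [MulAction G X] [Finite X] [MulAction G Y] [Finite Y]

/-- The extension of a Tambara ideal to all finite `G`-sets. -/
def onObj (I : R.TambaraIdeal) (X : Type u) [MulAction G X] [Finite X] : Ideal (R.obj X) :=
  ⨅ (H : Subgroup G) (f : (G ⧸ H) →[G] X), (I.carrier H).comap (R.res f)

variable {I J : R.TambaraIdeal}

theorem mem_onObj {a : R.obj X} : a ∈ I.onObj X ↔
    ∀ (H : Subgroup G) (f : (G ⧸ H) →[G] X), R.res f a ∈ I.carrier H := by
  simp only [onObj, Submodule.mem_iInf, Ideal.mem_comap]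

theorem mem_onObj_orbit {H : Subgroup G} {a : R.level H} :
    a ∈ I.onObj (G ⧸ H) ↔ a ∈ I.carrier H := by
  refine ⟨fun h => ?_, fun h => mem_onObj.2 fun K f => I.res_mem f h⟩
  have := mem_onObj.1 h H (MulActionHom.id G)
  rwa [R.res_id] at this

theorem res_mem_onObj (f : X →[G] Y) {a : R.obj Y} (h : a ∈ I.onObj Y) :
    R.res f a ∈ I.onObj X :=
  mem_onObj.2 fun H k => by
    rw [← R.res_comp]
    exact mem_onObj.1 h H _

theorem onObj_mono (h : I ≤ J) : I.onObj X ≤ J.onObj X := fun _ ha =>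
  mem_onObj.2 fun H f => h H (mem_onObj.1 ha H f)

theorem tr_mem_of_orbit {H : Subgroup G} (f : X →[G] (G ⧸ H)) {a : R.obj X} (h : a ∈ I.onObj X) :
    R.tr f a ∈ I.carrier H := by
  refine orbit_induction (G := G) (P := fun X _ _ => ∀ (f : X →[G] (G ⧸ H)) (a : R.obj X),
    a ∈ I.onObj X → R.tr f a ∈ I.carrier H) ?_ ?_ X f a h
  · intro X _ _ _ f a _
    rw [Subsingleton.elim a 0, map_zero]
    exact zero_mem _
  · intro X Y _ _ _ _ K _ i j hij ih f a h
    rw [R.tr_eq_add hij]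
    exact add_mem (I.tr_mem _ (mem_onObj.1 h K i)) (ih _ _ (res_mem_onObj j h))

/-- One orbit contributes a factor in the ideal, which absorbs the others. Over the empty set the
norm would be `1`. -/
theorem nm_mem_of_orbit [Nonempty X] {H : Subgroup G} (f : X →[G] (G ⧸ H)) {a : R.obj X}
    (h : a ∈ I.onObj X) : R.nm f a ∈ I.carrier H := by
  obtain ⟨K, Y, _, _, i, j, hij, -, -⟩ :=
    exists_orbit_decomposition (G := G) (Classical.arbitrary X)
  rw [R.nm_eq_mul hij]
  exact Ideal.mul_mem_right _ _ (I.nm_mem _ (mem_onObj.1 h K i))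

theorem tr_mem_onObj (f : X →[G] Y) {a : R.obj X} (h : a ∈ I.onObj X) : R.tr f a ∈ I.onObj Y :=
  mem_onObj.2 fun H q => by
    obtain ⟨E, _, _, u, v, hE⟩ := exists_isPullbackSquare f q
    rw [R.res_tr hE]
    exact tr_mem_of_orbit v (res_mem_onObj u h)

theorem nm_mem_onObj (f : X →[G] Y) (hf : Function.Surjective f) {a : R.obj X}
    (h : a ∈ I.onObj X) : R.nm f a ∈ I.onObj Y :=
  mem_onObj.2 fun H q => by
    obtain ⟨E, _, _, u, v, hE⟩ := exists_isPullbackSquare f q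
    obtain ⟨x, hx⟩ := hf (q ((1 : G) : G ⧸ H))
    obtain ⟨t, -, -⟩ := hE.existsUnique x _ hx
    have : Nonempty E := ⟨t⟩
    rw [R.res_nm hE]
    exact nm_mem_of_orbit v (res_mem_onObj u h)

end TambaraIdeal

/-! ### Restricting ideals to a component and extending them back. -/

section Component

variable {G : Type u} [Group G] [Finite G] {R : TambaraFunctor.{u, v} G}
variable {T : Type u} [MulAction G T] [Fintype T] (d : R.EquivariantIdempotents T)

namespace EquivariantIdempotents

section Single

variable {H : Subgroup G} (t : (G ⧸ H) →[G] T)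
variable {X Y : Type u} [MulAction H X] [Finite X] [MulAction H Y] [Finite Y]

/-- The idempotent cutting out the component. -/
noncomputable def unit (X : Type u) [MulAction H X] [Finite X] : R.obj (Induced H X) :=
  R.res (t.comp (Induced.proj H X)) d.tau

/-- The inclusion of the component. -/
noncomputable def val (a : (d.component t).obj X) : R.obj (Induced H X) := Subtype.val a

theorem val_injective : Function.Injective (d.val t (X := X)) := fun _ _ h => Subtype.ext h

theorem unit_mul_val (a : (d.component t).obj X) : d.unit t X * d.val t a = d.val t a :=
  (d.normIdempotent t).elem_mul a

theorem unit_idem : d.unit t X * d.unit t X = d.unit t X := ((d.normIdempotent t).idem X).eq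

theorem val_mul (a b : (d.component t).obj X) : d.val t (a * b) = d.val t a * d.val t b := rfl

theorem val_add (a b : (d.component t).obj X) : d.val t (a + b) = d.val t a + d.val t b := rfl

theorem val_zero : d.val t (0 : (d.component t).obj X) = 0 := rfl

theorem val_res (f : X →[H] Y) (a : (d.component t).obj Y) :
    d.val t ((d.component t).res f a) = R.res (Induced.map H f) (d.val t a) := rfl

/-- The projection to the component. -/
noncomputable def toComponent (X : Type u) [MulAction H X] [Finite X] :
    R.obj (Induced H X) →+* (d.component t).obj X where
  toFun a := (d.normIdempotent t).toCorner (X := X) (d.unit t X * a) (by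
    change d.unit t X * (d.unit t X * a) = d.unit t X * a
    rw [← mul_assoc, unit_idem])
  map_one' := Subtype.ext (mul_one (d.unit t X))
  map_zero' := Subtype.ext (mul_zero (d.unit t X))
  map_add' a b := Subtype.ext (mul_add (d.unit t X) a b)
  map_mul' a b := Subtype.ext (by
    change d.unit t X * (a * b) = (d.unit t X * a) * (d.unit t X * b)
    rw [mul_mul_mul_comm, unit_idem])

theorem val_toComponent (a : R.obj (Induced H X)) :
    d.val t (d.toComponent t X a) = d.unit t X * a := rfl

theorem toComponent_val (a : (d.component t).obj X) : d.toComponent t X (d.val t a) = a :=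
  d.val_injective t (d.unit_mul_val t a)

theorem res_unit (f : X →[H] Y) : R.res (Induced.map H f) (d.unit t Y) = d.unit t X :=
  (d.normIdempotent t).res_elem f

theorem toComponent_res (f : X →[H] Y) (a : R.obj (Induced H Y)) :
    d.toComponent t X (R.res (Induced.map H f) a) = (d.component t).res f (d.toComponent t Y a) :=
  d.val_injective t (by rw [val_res, val_toComponent, val_toComponent, map_mul, res_unit])

theorem toComponent_tr (f : X →[H] Y) (a : R.obj (Induced H X)) :
    d.toComponent t Y (R.tr (Induced.map H f) a) = (d.component t).tr f (d.toComponent t X a) :=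
  d.val_injective t ((d.normIdempotent t).elem_mul_tr f a)

theorem toComponent_nm (f : X →[H] Y) (a : R.obj (Induced H X)) :
    d.toComponent t Y (R.nm (Induced.map H f) a) = (d.component t).nm f (d.toComponent t X a) :=
  d.val_injective t ((d.normIdempotent t).elem_mul_nm f a)

/-- The ideal of the component given by an ideal of `R`. -/
noncomputable def restrictIdeal (I : R.TambaraIdeal) : (d.component t).TambaraIdeal where
  carrier K :=
    { carrier := {a | d.val t a ∈ I.onObj (Induced H (H ⧸ K))}
      add_mem' := fun {a b} ha hb => by
        change d.val t (a + b) ∈ I.onObj (Induced H (H ⧸ K))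
        rw [val_add]
        exact add_mem ha hb
      zero_mem' := zero_mem (I.onObj (Induced H (H ⧸ K)))
      smul_mem' := fun c a ha => by
        change d.val t (c * a) ∈ I.onObj (Induced H (H ⧸ K))
        rw [val_mul]
        exact Ideal.mul_mem_left _ _ ha }
  tr_mem f _ ha := TambaraIdeal.tr_mem_onObj (Induced.map H f) ha
  nm_mem f _ ha := Ideal.mul_mem_left _ _ (TambaraIdeal.nm_mem_onObj (Induced.map H f)
    (Induced.map_surjective (orbit_hom_surjective f)) ha)
  res_mem f _ ha := TambaraIdeal.res_mem_onObj (Induced.map H f) ha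

theorem mem_restrictIdeal {I : R.TambaraIdeal} {K : Subgroup H} {a : (d.component t).level K} :
    a ∈ (d.restrictIdeal t I).carrier K ↔ d.val t a ∈ I.onObj (Induced H (H ⧸ K)) := Iff.rfl

/-- Every orbit of `Induced H X` lies in the set induced from an `H`-orbit of `X`. -/
theorem mem_restrictIdeal_onObj {I : R.TambaraIdeal} {a : (d.component t).obj X} :
    a ∈ (d.restrictIdeal t I).onObj X ↔ d.val t a ∈ I.onObj (Induced H X) := by
  refine ⟨fun h => TambaraIdeal.mem_onObj.2 fun L f => ?_, fun h =>
    TambaraIdeal.mem_onObj.2 fun K f => (d.mem_restrictIdeal t).2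
      (TambaraIdeal.res_mem_onObj (Induced.map H f) h)⟩
  let p := f ((1 : G) : G ⧸ L)
  let k := orbitMap (MulAction.stabilizer H p.point) p.point fun _ h => h
  obtain ⟨l, hl⟩ := exists_lift_orbit f (Induced.map H k)
    (Induced.map_injective (orbitMap_stabilizer_injective p.point))
    (y := ⟨p.coset, ((1 : H) : H ⧸ MulAction.stabilizer H p.point)⟩)
    (Induced.ext rfl (orbitMap_one _ _ _))
  rw [← hl, R.res_comp]
  exact TambaraIdeal.mem_onObj.1 ((d.mem_restrictIdeal t).1 (TambaraIdeal.mem_onObj.1 h _ k)) _ l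

/-- The ideal of `R` given by an ideal of the component. -/
noncomputable def extendIdeal (J : (d.component t).TambaraIdeal) : R.TambaraIdeal where
  -- Testing on all finite `H`-sets makes closure under transfers and norms a base change, since
  -- `Fibre` is rarely an orbit.
  carrier L := ⨅ (Y : Type u) (_ : MulAction H Y) (_ : Finite Y) (f : Induced H Y →[G] (G ⧸ L)),
    (J.onObj Y).comap ((d.toComponent t Y).comp (R.res f))
  tr_mem f a ha := by
    simp only [Submodule.mem_iInf, Ideal.mem_comap, RingHom.comp_apply] at ha ⊢
    intro Y _ _ g
    rw [R.res_tr (Induced.Fibre.isPullbackSquare g f), toComponent_tr]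
    exact TambaraIdeal.tr_mem_onObj _ (ha _ _ _ _)
  nm_mem f a ha := by
    simp only [Submodule.mem_iInf, Ideal.mem_comap, RingHom.comp_apply] at ha ⊢
    intro Y _ _ g
    rw [R.res_nm (Induced.Fibre.isPullbackSquare g f), toComponent_nm]
    exact TambaraIdeal.nm_mem_onObj _
      (Induced.Fibre.fst_surjective g f (orbit_hom_surjective f)) (ha _ _ _ _)
  res_mem f a ha := by
    simp only [Submodule.mem_iInf, Ideal.mem_comap, RingHom.comp_apply] at ha ⊢
    intro Y _ _ g
    rw [← R.res_comp]
    exact ha Y _ _ _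

theorem mem_extendIdeal {J : (d.component t).TambaraIdeal} {L : Subgroup G} {a : R.level L} :
    a ∈ (d.extendIdeal t J).carrier L ↔ ∀ (Y : Type u) [MulAction H Y] [Finite Y]
      (f : Induced H Y →[G] (G ⧸ L)), d.toComponent t Y (R.res f a) ∈ J.onObj Y := by
  simp only [extendIdeal, Submodule.mem_iInf, Ideal.mem_comap, RingHom.comp_apply]

theorem restrictIdeal_mono {I J : R.TambaraIdeal} (h : I ≤ J) :
    d.restrictIdeal t I ≤ d.restrictIdeal t J := fun _ _ ha =>
  (d.mem_restrictIdeal t).2 (TambaraIdeal.onObj_mono h ((d.mem_restrictIdeal t).1 ha))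

theorem extendIdeal_mono {I J : (d.component t).TambaraIdeal} (h : I ≤ J) :
    d.extendIdeal t I ≤ d.extendIdeal t J := fun _ _ ha =>
  (mem_extendIdeal d t).2 fun Y _ _ f =>
    TambaraIdeal.onObj_mono h ((mem_extendIdeal d t).1 ha Y f)

theorem le_extendIdeal_restrictIdeal (I : R.TambaraIdeal) :
    I ≤ d.extendIdeal t (d.restrictIdeal t I) := fun _ _ ha =>
  (mem_extendIdeal d t).2 fun _ _ _ f => (d.mem_restrictIdeal_onObj t).2
    (Ideal.mul_mem_left _ _ (TambaraIdeal.res_mem_onObj f (TambaraIdeal.mem_onObj_orbit.2 ha)))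

theorem restrictIdeal_top : d.restrictIdeal t ⊤ = ⊤ := by
  refine le_antisymm (fun _ _ _ => Submodule.mem_top) fun K a _ => ?_
  exact (d.mem_restrictIdeal t).2 (TambaraIdeal.mem_onObj.2 fun _ _ => Submodule.mem_top)

theorem extendIdeal_top : d.extendIdeal t ⊤ = ⊤ := by
  refine le_antisymm (fun _ _ _ => Submodule.mem_top) fun K a _ => ?_
  exact (mem_extendIdeal d t).2 fun Y _ _ f =>
    TambaraIdeal.mem_onObj.2 fun _ _ => Submodule.mem_top

/-- The units of the two components are pullbacks of `tau` along pointwise different maps, hence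
orthogonal. -/
theorem toComponent_res_val_eq_zero {K : Subgroup G} (s : (G ⧸ K) →[G] T) {Z : Type u}
    [MulAction K Z] [Finite Z] (g : Induced H X →[G] Induced K Z)
    (hg : ∀ p, t p.coset ≠ s (g p).coset) (a : (d.component s).obj Z) :
    d.toComponent t X (R.res g (d.val s a)) = 0 := by
  refine d.val_injective t ?_
  rw [val_toComponent, ← d.unit_mul_val s a, map_mul, ← mul_assoc, unit, unit, ← R.res_comp,
    d.res_tau_mul_res_tau _ _ hg, zero_mul, val_zero]

end Single

end EquivariantIdempotents

end Component

end TambaraFunctor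

namespace Induced

open TambaraFunctor

variable {G : Type u} [Group G] {H : Subgroup G} {Y : Type u} [MulAction H Y]

theorem base_injective : Function.Injective (base : Y → Induced H Y) := fun _ _ h =>
  MulAction.injective (⟨_, out_one_mem⟩ : H)⁻¹ (Induced.ext_iff.1 h).2

theorem exists_base_eq {p : Induced H Y} (h : p.coset = ((1 : G) : G ⧸ H)) :
    ∃ y, base y = p :=
  ⟨(⟨_, out_one_mem⟩ : H) • p.point, Induced.ext h.symm (inv_smul_smul _ _)⟩

theorem exists_eq_smul_base {K : Subgroup H} (p : Induced H (H ⧸ K)) :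
    ∃ g : G, p = g • base ((1 : H) : H ⧸ K) := by
  obtain ⟨h, hh⟩ := coset_eq_smul_one p.point
  refine ⟨p.coset.out * h, ?_⟩
  rw [mul_smul, smul_base, ← hh, out_smul_base]

/-- A map out of an orbit either lies over `G/H` or moves all points of `G/H`. -/
theorem eq_map_or_coset_ne {K : Subgroup H} (g : Induced H (H ⧸ K) →[G] Induced H Y) :
    (∃ k : (H ⧸ K) →[H] Y, g = map H k) ∨ ∀ p, p.coset ≠ (g p).coset := by
  by_cases h : ∃ p, p.coset = (g p).coset
  · left
    obtain ⟨p, hp⟩ := h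
    have hall : ∀ q, q.coset = (g q).coset := by
      have h1 : ∀ (k : G) q, q.coset = (g q).coset → (k • q).coset = (g (k • q)).coset := by
        intro k q hq
        rw [map_smul]
        exact congrArg (k • ·) hq
      intro q
      obtain ⟨a, rfl⟩ := exists_eq_smul_base p
      obtain ⟨b, rfl⟩ := exists_eq_smul_base q
      have := h1 (b * a⁻¹) _ hp
      rwa [smul_smul, inv_mul_cancel_right] at this
    have hb : ∀ y : H ⧸ K, ∃ z : Y, base z = g (base y) := fun y =>
      exists_base_eq (hall (base y)).symm
    choose k hk using hb
    refine ⟨gMap k fun h y => base_injective (H := H) ?_, hom_ext_base fun y => ?_⟩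
    · rw [hk, ← smul_base, map_smul, ← hk, smul_base]
    · rw [map_base, ← hk]
      rfl
  · right
    exact fun p hp => h ⟨p, hp⟩

end Induced

namespace TambaraFunctor

namespace EquivariantIdempotents

variable {G : Type u} [Group G] [Finite G] {R : TambaraFunctor.{u, v} G}
variable {T : Type u} [MulAction G T] [Fintype T] (d : R.EquivariantIdempotents T)

/-- For `≤`, the transitive `G`-set `Induced H (H/K)` is an orbit, and testing on its identity
recovers `a`. For `≥`, a test map is either induced from `H`, where `J` is closed under restriction,
or moves every coset, where orthogonality gives zero. -/
theorem restrictIdeal_extendIdeal {H : Subgroup G} (t : (G ⧸ H) →[G] T)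
    (ht : Function.Injective t) (J : (d.component t).TambaraIdeal) :
    d.restrictIdeal t (d.extendIdeal t J) = J := by
  refine le_antisymm (fun K a ha => ?_) fun K a ha => ?_
  · let p : Induced H (H ⧸ K) := Induced.base ((1 : H) : H ⧸ K)
    let f := orbitMap (MulAction.stabilizer G p) p fun _ h => h
    obtain ⟨g, hg⟩ := exists_lift (MulActionHom.id G : Induced H (H ⧸ K) →[G] _) f
      (orbitMap_stabilizer_injective p) fun q => by
        obtain ⟨g, rfl⟩ := Induced.exists_eq_smul_base q
        exact ⟨(g : G ⧸ _), rfl⟩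
    have h := (d.mem_extendIdeal t).1 (TambaraIdeal.mem_onObj.1 ((d.mem_restrictIdeal t).1 ha) _ f) _ g
    rw [← R.res_comp, hg, R.res_id, toComponent_val] at h
    exact TambaraIdeal.mem_onObj_orbit.1 h
  · refine (d.mem_restrictIdeal t).2 (TambaraIdeal.mem_onObj.2 fun L f =>
      (d.mem_extendIdeal t).2 fun Y _ _ g => TambaraIdeal.mem_onObj.2 fun K' k => ?_)
    rw [← toComponent_res, ← R.res_comp, ← R.res_comp]
    rcases Induced.eq_map_or_coset_ne (f.comp (g.comp (Induced.map H k))) with ⟨l, hl⟩ | hne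
    · rw [hl, toComponent_res, toComponent_val]
      exact J.res_mem l ha
    · rw [d.toComponent_res_val_eq_zero t t _ fun p => ht.ne (hne p)]
      exact zero_mem _

theorem restrictIdeal_extendIdeal_of_disjoint {H K : Subgroup G} (t : (G ⧸ H) →[G] T)
    (s : (G ⧸ K) →[G] T) (hts : ∀ x y, t x ≠ s y) (J : (d.component t).TambaraIdeal) :
    d.restrictIdeal s (d.extendIdeal t J) = ⊤ := by
  refine le_antisymm (fun _ _ _ => Submodule.mem_top) fun L a _ => ?_
  refine (d.mem_restrictIdeal s).2 (TambaraIdeal.mem_onObj.2 fun M f =>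
    (d.mem_extendIdeal t).2 fun Y _ _ g => ?_)
  rw [← R.res_comp, d.toComponent_res_val_eq_zero t s _ fun p => hts _ _]
  exact zero_mem _

/-- The partition of unity writes `a` as a transfer from `G/L × T`. The part of this set over `G/H`
is `Induced H (G/L)`, embedded by `j`, and there the summand is the projection of `a` to the
component. -/
theorem mem_of_mem_extendIdeal_restrictIdeal (t : ∀ H : Subgroup G, (G ⧸ H) →[G] T)
    (ht : ∀ H, Function.Injective (t H)) (hcov : ∀ s, ∃ H x, t H x = s) {I : R.TambaraIdeal}
    {L : Subgroup G} {a : R.level L}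
    (ha : ∀ H, a ∈ (d.extendIdeal (t H) (d.restrictIdeal (t H) I)).carrier L) :
    a ∈ I.carrier L := by
  let pr : ((G ⧸ L) × T) →[G] (G ⧸ L) := gMap Prod.fst fun _ _ => rfl
  let pr' : ((G ⧸ L) × T) →[G] T := gMap Prod.snd fun _ _ => rfl
  have h1 : a = R.tr pr (R.res pr' d.tau * R.res pr a) := by
    rw [R.tr_mul_res, tr_res_tau, one_mul]
  rw [h1]
  refine TambaraIdeal.mem_onObj_orbit.1 (TambaraIdeal.tr_mem_onObj pr
    (TambaraIdeal.mem_onObj.2 fun M f => ?_))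
  obtain ⟨H, c, hc⟩ := hcov (f ((1 : G) : G ⧸ M)).2
  let x := (f ((1 : G) : G ⧸ M)).1
  let g : Induced H (G ⧸ L) →[G] (G ⧸ L) := Induced.desc id fun _ _ => rfl
  let j : Induced H (G ⧸ L) →[G] ((G ⧸ L) × T) := gMap (fun p => (g p, t H p.coset)) fun k p =>
    Prod.ext (_root_.map_smul g k p) (_root_.map_smul (t H) k p.coset)
  have hj : Function.Injective j := by
    rintro ⟨c, y⟩ ⟨c', y'⟩ h
    obtain ⟨h2, h3⟩ := Prod.mk.inj h
    obtain rfl : c = c' := ht H h3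
    exact Induced.ext rfl (MulAction.injective c.out h2)
  obtain ⟨k, hk⟩ := exists_lift_orbit f j hj (y := ⟨c, c.out⁻¹ • x⟩)
    (Prod.ext (smul_inv_smul c.out x) hc)
  have h2 : R.res j (R.res pr' d.tau * R.res pr a) =
      d.val (t H) (d.toComponent (t H) (G ⧸ L) (R.res g a)) := by
    rw [map_mul, ← R.res_comp, ← R.res_comp]
    rfl
  rw [← hk, R.res_comp, h2]
  exact TambaraIdeal.mem_onObj.1 ((d.mem_restrictIdeal_onObj (t H)).1
    ((d.mem_extendIdeal (t H)).1 (ha H) _ g)) _ k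

end EquivariantIdempotents

end TambaraFunctor

namespace TambaraFunctor

/-! ### Prime ideals and their transport between `R` and its components. -/

namespace TambaraIdeal

variable {G : Type u} [Group G] [Finite G] {R : TambaraFunctor.{u, v} G}
variable {I J P : R.TambaraIdeal}

theorem mem_sInf {S : Set R.TambaraIdeal} {H : Subgroup G} {a : R.level H} :
    a ∈ (sInf S).carrier H ↔ ∀ I ∈ S, a ∈ I.carrier H := by
  change a ∈ (⨅ I ∈ S, I.carrier H : Ideal (R.level H)) ↔ _
  simp only [Submodule.mem_iInf]

theorem mul_le_iff : I * J ≤ P ↔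
    ∀ H : Subgroup G, ∀ a ∈ I.carrier H, ∀ b ∈ J.carrier H, a * b ∈ P.carrier H :=
  ⟨fun h H a ha b hb => h H (mem_sInf.2 fun _ hL => hL H a ha b hb),
    fun h _ _ ha => mem_sInf.1 ha P h⟩

theorem le_top' : I ≤ ⊤ := fun _ _ _ => Submodule.mem_top

/-- A prime Tambara ideal containing a finite intersection contains one of its terms. -/
theorem IsPrime.exists_le_of_sInf_le (hP : P.IsPrime) {ι : Type*} [Finite ι]
    (I : ι → R.TambaraIdeal) (h : sInf (Set.range I) ≤ P) : ∃ i, I i ≤ P := by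
  classical
  have := Fintype.ofFinite ι
  have key : ∀ s : Finset ι, sInf (I '' s) ≤ P → ∃ i, I i ≤ P := by
    intro s
    induction s using Finset.induction_on with
    | empty =>
      intro h
      -- The empty intersection is the unit ideal, excluded because `P` is proper.
      refine (hP.ne_top (le_antisymm le_top' fun H a _ => h H (mem_sInf.2 ?_))).elim
      rintro _ ⟨i, hi, -⟩
      exact (Finset.notMem_empty i hi).elim
    | insert i s _ ih =>
      intro h
      have hm : I i * sInf (I '' s) ≤ P := mul_le_iff.2 fun H a ha b hb => h H (mem_sInf.2 (by
        rintro _ ⟨j, hj, rfl⟩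
        rcases Finset.mem_insert.1 hj with rfl | hj
        · exact Ideal.mul_mem_right _ _ ha
        · exact Ideal.mul_mem_left _ _ (mem_sInf.1 hb _ ⟨j, hj, rfl⟩)))
      rcases hP.le_or_le _ _ hm with h | h
      · exact ⟨i, h⟩
      · exact ih h
  exact key Finset.univ (by rwa [Finset.coe_univ, Set.image_univ])

end TambaraIdeal

theorem _root_.Induced.eq_one_of_smul_eq {G : Type u} [Group G] {H : Subgroup G} {g : G} {p : Induced H (H ⧸ (⊥ : Subgroup H))}
    (h : g • p = p) : g = 1 := by
  obtain ⟨h1, h2⟩ := Induced.ext_iff.1 h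
  have h3 := congrArg Subtype.val (smul_bot_eq_self h2)
  change g • p.coset = p.coset at h1
  simp only [Induced.cocycle, h1, Subgroup.coe_one] at h3
  rwa [inv_mul_eq_one, eq_comm, mul_eq_right] at h3

theorem NakaokaSpectrum.ext' {G : Type u} [Group G] [Finite G] {R : TambaraFunctor.{u, v} G}
    {P Q : R.NakaokaSpectrum}
    (h : P.ideal = Q.ideal) : P = Q := by
  cases P
  cases Q
  cases h
  rfl

namespace EquivariantIdempotents

variable {G : Type u} [Group G] [Finite G] {R : TambaraFunctor.{u, v} G}
variable {T : Type u} [MulAction G T] [Fintype T] (d : R.EquivariantIdempotents T)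

section Single

variable {H : Subgroup G} (t : (G ⧸ H) →[G] T)

theorem restrictIdeal_mul_le {I J : R.TambaraIdeal} {P : (d.component t).TambaraIdeal}
    (ht : Function.Injective t) (h : I * J ≤ d.extendIdeal t P) :
    d.restrictIdeal t I * d.restrictIdeal t J ≤ P := by
  rw [← d.restrictIdeal_extendIdeal t ht P]
  refine TambaraIdeal.mul_le_iff.2 fun K a ha b hb => (d.mem_restrictIdeal t).2 ?_
  rw [val_mul]
  refine TambaraIdeal.mem_onObj.2 fun L f => ?_
  rw [map_mul]
  exact TambaraIdeal.mul_le_iff.1 h L _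
    (TambaraIdeal.mem_onObj.1 ((d.mem_restrictIdeal t).1 ha) L f) _
    (TambaraIdeal.mem_onObj.1 ((d.mem_restrictIdeal t).1 hb) L f)

theorem extendIdeal_mul_le {I J P : (d.component t).TambaraIdeal} (h : I * J ≤ P) :
    d.extendIdeal t I * d.extendIdeal t J ≤ d.extendIdeal t P := by
  refine TambaraIdeal.mul_le_iff.2 fun L a ha b hb => (d.mem_extendIdeal t).2 fun Y _ _ f => ?_
  rw [map_mul, map_mul]
  refine TambaraIdeal.mem_onObj.2 fun K k => ?_
  rw [map_mul]
  exact TambaraIdeal.mul_le_iff.1 h K _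
    (TambaraIdeal.mem_onObj.1 ((d.mem_extendIdeal t).1 ha Y f) K k) _
    (TambaraIdeal.mem_onObj.1 ((d.mem_extendIdeal t).1 hb Y f) K k)

variable (ht : Function.Injective t)
include ht

theorem restrictIdeal_le_iff {I : R.TambaraIdeal} {J : (d.component t).TambaraIdeal} :
    d.restrictIdeal t I ≤ J ↔ I ≤ d.extendIdeal t J := by
  refine ⟨fun h => (d.le_extendIdeal_restrictIdeal t I).trans (d.extendIdeal_mono t h),
    fun h => ?_⟩
  rw [← d.restrictIdeal_extendIdeal t ht J]
  exact d.restrictIdeal_mono t h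

theorem isPrime_extendIdeal {P : (d.component t).TambaraIdeal} (hP : P.IsPrime) :
    (d.extendIdeal t P).IsPrime where
  ne_top h := hP.ne_top (by rw [← d.restrictIdeal_extendIdeal t ht P, h, restrictIdeal_top])
  le_or_le I J h := by
    rw [← d.restrictIdeal_le_iff t ht, ← d.restrictIdeal_le_iff t ht]
    exact hP.le_or_le _ _ (d.restrictIdeal_mul_le t ht h)

theorem isPrime_of_isPrime_extendIdeal {P : (d.component t).TambaraIdeal}
    (hP : (d.extendIdeal t P).IsPrime) : P.IsPrime where
  ne_top h := hP.ne_top (by rw [h, extendIdeal_top])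
  le_or_le I J h := by
    have := hP.le_or_le _ _ (d.extendIdeal_mul_le t h)
    rwa [← d.restrictIdeal_le_iff t ht, ← d.restrictIdeal_le_iff t ht,
      d.restrictIdeal_extendIdeal t ht, d.restrictIdeal_extendIdeal t ht] at this

end Single

/-! ### The spectrum as a disjoint union. -/

section Spectrum

variable (t : ∀ H : Subgroup G, (G ⧸ H) →[G] T) (ht : ∀ H, Function.Injective (t H))
variable (hdis : ∀ H K, H ≠ K → ∀ x y, t H x ≠ t K y) (hcov : ∀ s, ∃ H x, t H x = s)

/-- The map from the spectrum of a component to the spectrum of `R`. -/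
noncomputable def spectrumMap (H : Subgroup G) (P : (d.component (t H)).NakaokaSpectrum) :
    R.NakaokaSpectrum :=
  ⟨d.extendIdeal (t H) P.ideal, d.isPrime_extendIdeal (t H) (ht H) P.isPrime⟩

theorem preimage_V (H : Subgroup G) (I : R.TambaraIdeal) :
    d.spectrumMap t ht H ⁻¹' NakaokaSpectrum.V I =
      NakaokaSpectrum.V (d.restrictIdeal (t H) I) := by
  ext P
  exact (d.restrictIdeal_le_iff (t H) (ht H)).symm

/-- Adjointness pulls `V I` back to `V` of the restriction. Every `V J` arises this way, as `J` is
the restriction of its extension. -/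
theorem isInducing_spectrumMap (H : Subgroup G) :
    Topology.IsInducing (d.spectrumMap t ht H) := by
  refine ⟨le_antisymm ?_ ?_⟩
  · refine continuous_iff_le_induced.1 (continuous_generateFrom_iff.2 ?_)
    rintro _ ⟨I, rfl⟩
    rw [Set.preimage_compl, preimage_V]
    exact TopologicalSpace.isOpen_generateFrom_of_mem ⟨_, rfl⟩
  · refine le_generateFrom ?_
    rintro _ ⟨J, rfl⟩
    refine isOpen_induced_iff.2 ⟨(NakaokaSpectrum.V (d.extendIdeal (t H) J))ᶜ,
      TopologicalSpace.isOpen_generateFrom_of_mem ⟨_, rfl⟩, ?_⟩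
    rw [Set.preimage_compl, preimage_V, d.restrictIdeal_extendIdeal (t H) (ht H)]

include hcov in
-- The extended restrictions of `Q` have intersection inside `Q`, so primality puts one of them
-- inside `Q`; the unit of the adjunction gives equality.
theorem exists_spectrumMap_eq (Q : R.NakaokaSpectrum) : ∃ H P, d.spectrumMap t ht H P = Q := by
  obtain ⟨H, hH⟩ := Q.isPrime.exists_le_of_sInf_le
    (fun H => d.extendIdeal (t H) (d.restrictIdeal (t H) Q.ideal)) fun L a ha =>
      d.mem_of_mem_extendIdeal_restrictIdeal t ht hcov fun H =>
        TambaraIdeal.mem_sInf.1 ha _ ⟨H, rfl⟩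
  have h := le_antisymm hH (d.le_extendIdeal_restrictIdeal (t H) Q.ideal)
  exact ⟨H, ⟨d.restrictIdeal (t H) Q.ideal, d.isPrime_of_isPrime_extendIdeal (t H) (ht H)
    (by rw [h]; exact Q.isPrime)⟩, NakaokaSpectrum.ext' h⟩

include hdis in
theorem restrictIdeal_spectrumMap {H K : Subgroup G} (hHK : H ≠ K)
    (P : (d.component (t H)).NakaokaSpectrum) :
    d.restrictIdeal (t K) (d.spectrumMap t ht H P).ideal = ⊤ :=
  d.restrictIdeal_extendIdeal_of_disjoint (t H) (t K) (hdis H K hHK) P.ideal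

theorem restrictIdeal_spectrumMap_self (H : Subgroup G)
    (P : (d.component (t H)).NakaokaSpectrum) :
    d.restrictIdeal (t H) (d.spectrumMap t ht H P).ideal = P.ideal :=
  d.restrictIdeal_extendIdeal (t H) (ht H) P.ideal

include hdis in
theorem eq_of_spectrumMap_eq {H K : Subgroup G} {P : (d.component (t H)).NakaokaSpectrum}
    {Q : (d.component (t K)).NakaokaSpectrum}
    (h : d.spectrumMap t ht H P = d.spectrumMap t ht K Q) : H = K := by
  by_contra hHK
  refine Q.isPrime.ne_top ?_
  rw [← d.restrictIdeal_spectrumMap_self t ht K Q, ← h,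
    d.restrictIdeal_spectrumMap t ht hdis hHK]

include hdis hcov in
theorem bijective_spectrumMap : Function.Bijective
    (fun p : Σ H, (d.component (t H)).NakaokaSpectrum => d.spectrumMap t ht p.1 p.2) := by
  constructor
  · rintro ⟨H, P⟩ ⟨K, Q⟩ h
    obtain rfl := d.eq_of_spectrumMap_eq t ht hdis h
    have h' : P.ideal = Q.ideal := by
      rw [← d.restrictIdeal_spectrumMap_self t ht H P, ← d.restrictIdeal_spectrumMap_self t ht H Q]
      exact congrArg (fun S => d.restrictIdeal (t H) (NakaokaSpectrum.ideal S)) h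
    rw [NakaokaSpectrum.ext' h']
  · intro Q
    obtain ⟨H, P, h⟩ := d.exists_spectrumMap_eq t ht hcov Q
    exact ⟨⟨H, P⟩, h⟩

include hdis hcov in
-- The image of the `K`-th spectrum is `V` of the extension of the least ideal `sInf Set.univ`: a
-- prime from another component containing it would restrict there to the unit ideal. So each image
-- is open, as a complement of finitely many closed sets.
theorem range_spectrumMap (H : Subgroup G) : Set.range (d.spectrumMap t ht H) =
    ⋂ K ∈ ({H}ᶜ : Set (Subgroup G)),
      (NakaokaSpectrum.V (d.extendIdeal (t K) (sInf Set.univ)))ᶜ := by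
  ext Q
  obtain ⟨H', P, rfl⟩ := d.exists_spectrumMap_eq t ht hcov Q
  simp only [Set.mem_iInter, Set.mem_compl_iff, Set.mem_singleton_iff]
  constructor
  · rintro ⟨P', h⟩ K hK hV
    refine P'.isPrime.ne_top (le_antisymm TambaraIdeal.le_top' ?_)
    rw [← h] at hV
    have h1 := (d.restrictIdeal_le_iff (t H) (ht H)).2 hV
    rwa [d.restrictIdeal_extendIdeal_of_disjoint (t K) (t H) (hdis K H hK)] at h1
  · intro h
    have : H' = H := by
      by_contra hne
      exact h H' hne (d.extendIdeal_mono (t H') fun _ _ ha =>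
        TambaraIdeal.mem_sInf.1 ha _ (Set.mem_univ _))
    subst this
    exact ⟨P, rfl⟩

include ht hdis hcov in
theorem nonempty_homeomorph : Nonempty
    (R.NakaokaSpectrum ≃ₜ Σ H, (d.component (t H)).NakaokaSpectrum) := by
  refine ⟨((Equiv.ofBijective _
    (d.bijective_spectrumMap t ht hdis hcov)).toHomeomorphOfContinuousOpen ?_ ?_).symm⟩
  · exact continuous_sigma fun H => (d.isInducing_spectrumMap t ht H).continuous
  · refine isOpenMap_sigma.2 fun H => (d.isInducing_spectrumMap t ht H).isOpenMap ?_
    rw [d.range_spectrumMap t ht hdis hcov]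
    exact (Set.toFinite _).isOpen_biInter fun K _ =>
      TopologicalSpace.isOpen_generateFrom_of_mem ⟨_, rfl⟩

end Spectrum

/-! ### Clarifiedness of the components. -/

section Clarified

variable {H : Subgroup G} (t : (G ⧸ H) →[G] T)

/-- `Induced H (H/e)` is a free transitive `G`-set, so evaluation at its base point is injective. It
commutes with the action of `H` and lands below the idempotent of the base coset, which reduces the
claim to `R(G/e)`. -/
theorem isClarified_component
    (h : ∀ x : R.level ⊥, IsIdempotentElem x → x * d.toFun (t ((1 : G) : G ⧸ H)) = x → x ≠ 0 →
      ∀ g ∈ H, x * R.conj g x ≠ 0) : (d.component t).IsClarified := by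
  rintro ⟨c, hc0, hc, g, hcg⟩
  let p : Induced H (H ⧸ (⊥ : Subgroup H)) := Induced.base ((1 : H) : H ⧸ (⊥ : Subgroup H))
  refine h (R.ev p (d.val t c)) ?_ ?_ ?_ g g.2 ?_
  · rw [IsIdempotentElem, ← map_mul, ← val_mul, hc.eq]
  · have h1 : R.ev p (d.unit t _) = R.ev (t ((1 : G) : G ⧸ H)) d.tau := R.ev_res _ p d.tau
    rw [← d.unit_mul_val t c, map_mul, h1, mul_right_comm, ev_tau_mul]
  · intro h0
    refine hc0 (d.val_injective t (R.ext_free (fun _ _ => Induced.eq_one_of_smul_eq) fun q => ?_))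
    obtain ⟨k, rfl⟩ := Induced.exists_eq_smul_base q
    rw [ev_smul, h0, val_zero, map_zero, map_zero]
  · have h1 : R.ev p (d.val t ((d.component t).conj g c)) = R.conj g (R.ev p (d.val t c)) := by
      rw [conj, val_res, ev_res, ← ev_smul, Induced.smul_base, Induced.map_base]
      congr 3
      exact congrArg (QuotientGroup.mk (s := (⊥ : Subgroup H))) ((one_mul g).trans (mul_one g).symm)
    rw [← h1, ← map_mul, ← val_mul, hcg, val_zero, map_zero]

end Clarified

end EquivariantIdempotents

end TambaraFunctor

/-! ### Idempotents of Noetherian rings with a group action. -/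

section Idempotents

variable {A : Type*} [CommRing A]

/-- An idempotent is determined by the minimal primes containing it, of which there are finitely
many: if `a` and `b` lie in the same ones, `a * (1 - b)` is nilpotent and idempotent. -/
theorem finite_idempotents [IsNoetherianRing A] : Finite {a : A // IsIdempotentElem a} := by
  have hfin : Finite (minimalPrimes A) := (minimalPrimes.finite_of_isNoetherianRing A).to_subtype
  refine Finite.of_injective
    (fun a : {a : A // IsIdempotentElem a} => {p : minimalPrimes A | a.1 ∈ p.1}) ?_
  have key : ∀ a b : {a : A // IsIdempotentElem a},
      {p : minimalPrimes A | a.1 ∈ p.1} = {p : minimalPrimes A | b.1 ∈ p.1} → a.1 * b.1 = a.1 := by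
    intro a b h
    have hn : a.1 * (1 - b.1) ∈ nilradical A := by
      rw [nilradical, Ideal.zero_eq_bot, ← Ideal.sInf_minimalPrimes, Submodule.mem_sInf]
      intro p hp
      by_cases ha : a.1 ∈ p
      · exact Ideal.mul_mem_right _ _ ha
      · have hb : b.1 ∉ p := fun hb => ha ((Set.ext_iff.1 h ⟨p, hp⟩).2 hb)
        refine Ideal.mul_mem_left _ _ ((hp.1.1.mem_or_mem ?_).resolve_left hb)
        rw [mul_sub, mul_one, b.2.eq, sub_self]
        exact zero_mem _
    obtain ⟨n, hn⟩ := hn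
    have h0 : a.1 * (1 - b.1) = 0 := by
      have hi : IsIdempotentElem (a.1 * (1 - b.1)) := a.2.mul b.2.one_sub
      rw [← hi.pow_succ_eq n, pow_succ, hn, zero_mul]
    rw [mul_sub, mul_one, sub_eq_zero] at h0
    exact h0.symm
  intro a b h
  refine Subtype.ext ?_
  rw [← key a b h, mul_comm, key b a h.symm]

/-- Primitive idempotents of a commutative ring. -/
structure IsPrimitiveIdempotent (t : A) : Prop where
  idem : IsIdempotentElem t
  ne_zero : t ≠ 0
  eq_of_mul_eq : ∀ x, IsIdempotentElem x → x * t = x → x ≠ 0 → x = t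

theorem IsPrimitiveIdempotent.mul_eq_zero {s t : A} (hs : IsPrimitiveIdempotent s)
    (ht : IsPrimitiveIdempotent t) (hst : s ≠ t) : s * t = 0 := by
  by_contra h
  refine hst ((hs.eq_of_mul_eq _ (hs.idem.mul ht.idem) ?_ h).symm.trans
    (ht.eq_of_mul_eq _ (hs.idem.mul ht.idem) ?_ h))
  · rw [mul_right_comm, hs.idem.eq]
  · rw [mul_assoc, ht.idem.eq]

variable [IsNoetherianRing A]

theorem exists_isPrimitiveIdempotent {e : A} (he : IsIdempotentElem e) (h0 : e ≠ 0) :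
    ∃ t, IsPrimitiveIdempotent t ∧ t * e = t := by
  have := finite_idempotents (A := A)
  obtain h | ⟨t, ht, hte⟩ := eq_bot_or_exists_atom_le (⟨e, he⟩ : {a : A // IsIdempotentElem a})
  · exact (h0 (congrArg Subtype.val h)).elim
  · refine ⟨t.1, ⟨t.2, fun h => ht.1 (Subtype.ext h), fun x hx hxt hx0 => ?_⟩, hte⟩
    have hle : (⟨x, hx⟩ : {a : A // IsIdempotentElem a}) ≤ t := hxt
    rcases ht.le_iff.1 hle with h | h
    · exact (hx0 (congrArg Subtype.val h)).elim
    · exact congrArg Subtype.val h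

theorem finite_primitiveIdempotents : Finite {t : A // IsPrimitiveIdempotent t} :=
  have := finite_idempotents (A := A)
  Finite.of_injective (fun t => (⟨t.1, t.2.idem⟩ : {a : A // IsIdempotentElem a}))
    fun _ _ h => Subtype.ext (congrArg (fun a => a.1) h)

/-- An element killed by all primitive idempotents vanishes. -/
theorem eq_zero_of_primitive_mul {x : A} (h : ∀ t, IsPrimitiveIdempotent t → t * x = 0) :
    x = 0 := by
  have := finite_primitiveIdempotents (A := A)
  have := Fintype.ofFinite {t : A // IsPrimitiveIdempotent t}
  have hs : ∀ t, IsPrimitiveIdempotent t →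
      t * ∑ s : {t : A // IsPrimitiveIdempotent t}, s.1 = t := by
    intro t ht
    rw [Finset.mul_sum, Finset.sum_eq_single ⟨t, ht⟩]
    · exact ht.idem
    · exact fun s _ hst => ht.mul_eq_zero s.2 fun h => hst (Subtype.ext h.symm)
    · exact fun h => (h (Finset.mem_univ _)).elim
  have h1 : (1 : A) - ∑ s : {t : A // IsPrimitiveIdempotent t}, s.1 = 0 := by
    by_contra h0
    have hi : IsIdempotentElem (∑ s : {t : A // IsPrimitiveIdempotent t}, s.1) := by
      rw [IsIdempotentElem, Finset.sum_mul]
      exact Finset.sum_congr rfl fun t _ => hs t.1 t.2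
    obtain ⟨t, ht, hte⟩ := exists_isPrimitiveIdempotent hi.one_sub h0
    rw [mul_sub, mul_one, hs t ht, sub_self] at hte
    exact ht.ne_zero hte.symm
  rw [← one_mul x, sub_eq_zero.1 h1, Finset.sum_mul]
  exact Finset.sum_eq_zero fun t _ => h t.1 t.2

variable {G : Type*} [Group G] [MulSemiringAction G A]

omit [IsNoetherianRing A] in
theorem IsPrimitiveIdempotent.smul {t : A} (ht : IsPrimitiveIdempotent t) (g : G) :
    IsPrimitiveIdempotent (g • t) where
  idem := by rw [IsIdempotentElem, ← smul_mul', ht.idem.eq]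
  ne_zero h := ht.ne_zero (by rw [← inv_smul_smul g t, h, smul_zero])
  eq_of_mul_eq x hx hxt hx0 := by
    rw [eq_comm, ← eq_inv_smul_iff, eq_comm]
    refine ht.eq_of_mul_eq _ ?_ ?_ ?_
    · rw [IsIdempotentElem, ← smul_mul', hx.eq]
    · conv_lhs => rw [← inv_smul_smul g t]
      rw [← smul_mul', hxt]
    · exact fun h => hx0 (by rw [← smul_inv_smul g x, h, smul_zero])

variable (A G) in
/-- Every Noetherian ring with an action of `G` has idempotents `e H`, fixed by `H`, with pairwise
orthogonal translates that sum up to `1`, such that `H` fixes all idempotents below `e H`. -/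
theorem exists_orbit_idempotents [Finite G] [Fintype (Σ H : Subgroup G, G ⧸ H)] :
    ∃ e : Subgroup G → A, (∀ H, e H * e H = e H) ∧ (∀ H, ∀ h ∈ H, h • e H = e H) ∧
      (∀ H K, ∀ g : G, (H = K → g ∉ H) → e H * g • e K = 0) ∧
      (∑ s : Σ H : Subgroup G, G ⧸ H, s.2.out • e s.1 = 1) ∧
      ∀ H x, IsIdempotentElem x → x * e H = x → x ≠ 0 → ∀ h ∈ H, x * h • x ≠ 0 := by
  classical
  have := finite_primitiveIdempotents (A := A)
  have := Fintype.ofFinite {t : A // IsPrimitiveIdempotent t}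
  let : MulAction G {t : A // IsPrimitiveIdempotent t} :=
    { smul := fun g t => ⟨g • t.1, t.2.smul g⟩
      one_smul := fun t => Subtype.ext (one_smul G t.1)
      mul_smul := fun g h t => Subtype.ext (mul_smul g h t.1) }
  let rep : {t : A // IsPrimitiveIdempotent t} → {t : A // IsPrimitiveIdempotent t} := fun t =>
    Quotient.out (s := MulAction.orbitRel G _) (Quotient.mk (MulAction.orbitRel G _) t)
  have hrep : ∀ t, ∃ g : G, g • rep t = t := fun t =>
    MulAction.orbitRel_apply.1 ((MulAction.orbitRel G _).symm (Quotient.mk_out (s := MulAction.orbitRel G _) t))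
  have hrep' : ∀ (g : G) t, rep (g • t) = rep t := fun g t =>
    congrArg (Quotient.out (s := MulAction.orbitRel G _)) (Quotient.sound (s := MulAction.orbitRel G _)
      (MulAction.orbitRel_apply.2 ⟨g, rfl⟩))
  have hrr : ∀ t, rep (rep t) = rep t := fun t => by
    obtain ⟨g, hg⟩ := hrep t
    conv_rhs => rw [← hg, hrep']
  -- Only the chosen representative of each orbit enters, so an orbit is counted for one subgroup
  -- and not for its conjugates.
  let F : Subgroup G → Finset {t : A // IsPrimitiveIdempotent t} := fun H =>
    Finset.univ.filter fun t => rep t = t ∧ MulAction.stabilizer G t = H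
  have hF : ∀ H t, t ∈ F H ↔ rep t = t ∧ MulAction.stabilizer G t = H := fun H t => by
    simp only [F, Finset.mem_filter, Finset.mem_univ, true_and]
  let e : Subgroup G → A := fun H => ∑ t ∈ F H, t.1
  have hmem : ∀ H, ∀ t ∈ F H, t.1 * e H = t.1 := by
    intro H t ht
    rw [Finset.mul_sum, Finset.sum_eq_single t]
    · exact t.2.idem
    · exact fun s _ hst => t.2.mul_eq_zero s.2 fun h => hst (Subtype.ext h.symm)
    · exact fun h => (h ht).elim
  have hfix : ∀ H, ∀ h ∈ H, h • e H = e H := by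
    intro H h hh
    rw [Finset.smul_sum]
    refine Finset.sum_congr rfl fun t ht => ?_
    have : h • t = t := by
      rw [← MulAction.mem_stabilizer_iff, ((hF H t).1 ht).2]
      exact hh
    exact congrArg Subtype.val this
  have horth : ∀ H K, ∀ g : G, (H = K → g ∉ H) → e H * g • e K = 0 := by
    intro H K g hg
    rw [Finset.smul_sum, Finset.sum_mul_sum]
    refine Finset.sum_eq_zero fun s hs => Finset.sum_eq_zero fun t ht => ?_
    refine s.2.mul_eq_zero (t.2.smul g) fun h => ?_
    have hst : s = g • t := Subtype.ext h
    obtain ⟨hs1, hs2⟩ := (hF H s).1 hs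
    obtain ⟨ht1, ht2⟩ := (hF K t).1 ht
    have hst' : s = t := by rw [← hs1, hst, hrep', ht1]
    subst hst'
    exact hg (hs2.symm.trans ht2) (hs2 ▸ MulAction.mem_stabilizer_iff.2 hst.symm)
  refine ⟨e, fun H => ?_, hfix, horth, ?_, ?_⟩
  · conv_lhs => rw [Finset.sum_mul]
    exact Finset.sum_congr rfl (hmem H)
  · rw [← sub_eq_zero]
    -- It suffices to multiply by each primitive `t`: exactly one translate of one `e H` contains
    -- it, the others being orthogonal to that one.
    refine eq_zero_of_primitive_mul fun t ht => ?_
    rw [mul_sub, mul_one, sub_eq_zero]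
    obtain ⟨g, hg⟩ := hrep ⟨t, ht⟩
    let H := MulAction.stabilizer G (rep ⟨t, ht⟩)
    have h1 : t * g • e H = t := by
      have h2 := hmem H (rep ⟨t, ht⟩) ((hF _ _).2 ⟨hrr _, rfl⟩)
      have h3 : g • (rep ⟨t, ht⟩).1 = t := congrArg Subtype.val hg
      calc t * g • e H = g • (rep ⟨t, ht⟩).1 * g • e H := by rw [h3]
        _ = t := by rw [← smul_mul', h2, h3]
    rw [Finset.mul_sum, Finset.sum_eq_single ⟨H, (g : G ⧸ H)⟩]
    · obtain ⟨k, hk⟩ := QuotientGroup.mk_out_eq_mul H g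
      change t * (g : G ⧸ H).out • e H = t
      rw [hk, mul_smul, hfix H k.1 k.2, h1]
    · rintro ⟨K, c⟩ - hne
      rw [← h1, mul_assoc]
      have h4 : g • e H * c.out • e K = g • (e H * (g⁻¹ * c.out) • e K) := by
        rw [smul_mul', smul_smul, mul_inv_cancel_left]
      change t * (g • e H * c.out • e K) = 0
      rw [h4, horth H K, smul_zero, mul_zero]
      rintro rfl hmem
      refine hne ?_
      have h5 : (g : G ⧸ H) = c := (QuotientGroup.eq.2 hmem).trans (QuotientGroup.out_eq' c)
      rw [h5]
    · exact fun h => (h (Finset.mem_univ _)).elim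
  · intro H x hx hxe hx0 h hh h0
    -- A primitive `t` below `x` is a summand of `e H`, hence fixed by `H`, so it also lies below `h
    -- • x`.
    obtain ⟨t, ht, htx⟩ := exists_isPrimitiveIdempotent hx hx0
    have hte : t * e H ≠ 0 := by
      rw [← htx, mul_assoc, hxe, htx]
      exact ht.ne_zero
    have hs : ∃ s ∈ F H, t * s.1 ≠ 0 := by
      by_contra! hs
      exact hte (by rw [Finset.mul_sum]; exact Finset.sum_eq_zero hs)
    obtain ⟨s, hs, hts⟩ := hs
    have hts : t = s.1 := by
      by_contra hne
      exact hts (ht.mul_eq_zero s.2 hne)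
    have hht : h • t = t := by
      have h1 : h • s = s := by
        rw [← MulAction.mem_stabilizer_iff, ((hF H s).1 hs).2]
        exact hh
      rw [hts]
      exact congrArg Subtype.val h1
    refine ht.ne_zero ?_
    calc t = h • (t * x) := by rw [htx, hht]
      _ = t * x * h • x := by rw [smul_mul', hht, htx]
      _ = 0 := by rw [mul_assoc, h0, mul_zero]

end Idempotents

theorem mainTheorem9 {G : Type u} [Group G] [Finite G] (R : TambaraFunctor.{u, v} G)
    (hR : IsNoetherianRing (R.level ⊥)) :
    ∃ S : ∀ H : Subgroup G, TambaraFunctor.{u, v} H,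
      (∀ H : Subgroup G, (S H).IsClarified) ∧
      Nonempty (R.NakaokaSpectrum ≃ₜ Σ H : Subgroup G, (S H).NakaokaSpectrum) := by
  let : MulSemiringAction G (R.level ⊥) :=
    { smul := fun g a => R.conj g a
      one_smul := R.conj_one
      mul_smul := R.conj_mul
      smul_zero := fun g => map_zero (R.conj g)
      smul_add := fun g => map_add (R.conj g)
      smul_one := fun g => map_one (R.conj g)
      smul_mul := fun g => map_mul (R.conj g) }
  have := Fintype.ofFinite (Σ H : Subgroup G, G ⧸ H)
  obtain ⟨e, hidem, hfix, horth, hsum, hclar⟩ := exists_orbit_idempotents (R.level ⊥) G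
  -- The translate for a coset uses its chosen representative. Equivariance holds because the
  -- resulting cocycle has values in `H`, which fixes `e H`.
  let d : R.EquivariantIdempotents (Σ H : Subgroup G, G ⧸ H) :=
    { toFun := fun s => s.2.out • e s.1
      map_smul := fun g s => by
        change (g • s.2).out • e s.1 = g • s.2.out • e s.1
        have h := hfix s.1 _ (Induced.cocycle g s.2).2
        conv_lhs => rw [← h]
        rw [smul_smul, smul_smul]
        simp only [Induced.cocycle]
        rw [mul_inv_cancel_left]
      idem := fun s => by rw [← smul_mul', hidem]
      orth := fun s s' hne => by
        obtain ⟨H, c⟩ := s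
        obtain ⟨K, c'⟩ := s'
        have h : c.out • e H * c'.out • e K = c.out • (e H * (c.out⁻¹ * c'.out) • e K) := by
          rw [smul_mul', smul_smul, mul_inv_cancel_left]
        change c.out • e H * c'.out • e K = 0
        rw [h, horth H K, smul_zero]
        rintro rfl hm
        refine hne ?_
        rw [← QuotientGroup.out_eq' c, ← QuotientGroup.out_eq' c', QuotientGroup.eq.2 hm]
      sum_eq_one := hsum }
  let t : ∀ H : Subgroup G, (G ⧸ H) →[G] (Σ H : Subgroup G, G ⧸ H) := fun H =>
    TambaraFunctor.gMap (Sigma.mk H) fun _ _ => rfl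
  refine ⟨fun H => d.component (t H), fun H => d.isClarified_component (t H) ?_,
    d.nonempty_homeomorph t (fun H => sigma_mk_injective)
      (fun H K hne x y h => hne (Sigma.mk.inj h).1) fun s => ⟨s.1, s.2, rfl⟩⟩
  intro x hx hxe hx0 g hg
  refine hclar H x hx ?_ hx0 g hg
  -- The idempotent attached to the base coset is `e H` itself, whatever its representative.
  have h : ((1 : G) : G ⧸ H).out • e H = e H := hfix H _ Induced.out_one_mem
  rw [← h]
  exact hxe
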